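/- Let $\mathcal R(s)=\int_{0\swarrow1}\frac{x^{-s}e^{\pi i x^2}}{e^{\pi i x}-e^{-\pi i x}}\,dx$ be Riemann's auxiliary function; here the integral is along a straight line of direction $e^{-3\pi i/4}$ that crosses the real axis between $0$ and $1$ and is run through from the upper right to the lower left, and $x^{-s}$ is the principal branch. Let $\chi(s)=2(2\pi)^{s-1}\sin(\pi s/2)\,\Gamma(1-s)$ be the factor in the functional equation $\zeta(s)=\chi(s)\zeta(1-s)$. For $s=\sigma+it$ with $0<\arg(s-1)<2\pi$, put $\eta=\sqrt{\frac{s-1}{2\pi i}}$ with $-\frac{\pi}{4}<\arg\eta<\frac{3\pi}{4}$, and let $\eta^{s-1}$ be formed with this value of $\arg\eta$. Let $0<\alpha<\frac{\pi}{4}$, and let $G_\alpha$ be the closed set of all $s=\sigma+it\in\mathbb C$ with $|t|\tan 2\alpha\le 1-\sigma$. Then, as $s\to\infty$ with $s\in G_\alpha$, $$\mathcal R(s)=\frac{e^{-\pi i/8}}{\sqrt2}\,\chi(s)\,\eta^{s-1}e^{\pi i(\eta-\eta^2)}\bigl(1+O(|\eta|^{-1})\bigr),$$ where the constant implied by $O$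 may depend on $\alpha$. -/

import Mathlib

open Filter Asymptotics

noncomputable section

namespace RiemannAux

/-- The straight line `0 ↙ 1`, parametrized by arc length: it runs from the upper right to the
lower left, in the direction `e^{-3πi/4}`, and meets the real axis only at `1/2`.  (By Cauchy's
theorem every crossing point between `0` and `1` gives the same integral below.) -/
def path (u : ℝ) : ℂ :=
  1 / 2 + (u : ℂ) * Complex.exp (-(3 * Real.pi * Complex.I / 4))

/-- The integrand `x^{-s} e^{πix²} / (e^{πix} - e^{-πix})`, with the principal branch of `x^{-s}`
(the line `0 ↙ 1` does not meet the cut along the nonpositive real axis). -/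
def integrand (s x : ℂ) : ℂ :=
  x ^ (-s) * Complex.exp (Real.pi * Complex.I * x ^ 2) /
    (Complex.exp (Real.pi * Complex.I * x) - Complex.exp (-(Real.pi * Complex.I * x)))

/-- Riemann's auxiliary function `𝓡(s) = ∫_{0↙1} x^{-s} e^{πix²} / (e^{πix} - e^{-πix}) dx`;
the constant factor is `dx/du`. -/
def auxR (s : ℂ) : ℂ :=
  ∫ u : ℝ, integrand s (path u) * Complex.exp (-(3 * Real.pi * Complex.I / 4))

/-- The factor of the functional equation `ζ(s) = χ(s) ζ(1-s)`. -/
def chi (s : ℂ) : ℂ :=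
  2 * (2 * Real.pi : ℂ) ^ (s - 1) * Complex.sin (Real.pi * s / 2) * Complex.Gamma (1 - s)

/-- The saddle point: `η` is the square root of `(s-1)/(2πi)` with `-π/4 < arg η < 3π/4`, for `s`
off the ray `[1, ∞)`; see `eta_sq` and `arg_eta_mem`. -/
def eta (s : ℂ) : ℂ :=
  Complex.exp (Real.pi * Complex.I / 4) * ((1 - s) / (2 * Real.pi)) ^ (1 / 2 : ℂ)

/-- The closed set `G_α`, defined by `|t| tan 2α ≤ 1 - σ` for `s = σ + it`. -/
def G (α : ℝ) : Set ℂ :=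
  {s | |s.im| * Real.tan (2 * α) ≤ 1 - s.re}

theorem chi_functional_equation {s : ℂ} (hs : ∀ n : ℕ, s ≠ n + 1) (hs0 : s ≠ 0) :
    riemannZeta s = chi s * riemannZeta (1 - s) := by
  have h := riemannZeta_one_sub (s := 1 - s)
    (fun n h => hs n (by linear_combination -h)) (fun h => hs0 (by linear_combination -h))
  have e : (Real.pi : ℂ) * (1 - s) / 2 = Real.pi / 2 - Real.pi * s / 2 := by ring
  rw [sub_sub_cancel, neg_sub, e, Complex.cos_pi_div_two_sub] at h
  rw [h, chi]
  ring

theorem eta_sq (s : ℂ) : eta s ^ 2 = (s - 1) / (2 * Real.pi * Complex.I) := by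
  have hpi : (Real.pi : ℂ) ≠ 0 := by exact_mod_cast Real.pi_ne_zero
  have h1 : Complex.exp (Real.pi * Complex.I / 4) ^ 2 = Complex.I := by
    have e : ((2 : ℕ) : ℂ) * (Real.pi * Complex.I / 4) = Real.pi / 2 * Complex.I := by
      push_cast
      ring
    rw [← Complex.exp_nat_mul, e, Complex.exp_pi_div_two_mul_I]
  have h2 : (((1 - s) / (2 * Real.pi)) ^ (1 / 2 : ℂ)) ^ 2 = (1 - s) / (2 * Real.pi) := by
    simp
  rw [eta, mul_pow, h1, h2]
  field_simp
  linear_combination (1 - s) * Complex.I_sq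

theorem arg_eta_mem {s : ℂ} (hs : 1 - s ∈ Complex.slitPlane) :
    -(Real.pi / 4) < (eta s).arg ∧ (eta s).arg < 3 * Real.pi / 4 := by
  have hpi := Real.pi_pos
  set z : ℂ := (1 - s) / (2 * Real.pi) with hz
  have hz' : z = (((2 * Real.pi)⁻¹ : ℝ) : ℂ) * (1 - s) := by
    rw [hz]; push_cast; rw [div_eq_inv_mul]
  have harg : z.arg = (1 - s).arg := by
    rw [hz', Complex.arg_real_mul _ (by positivity)]
  have hlt := (Complex.mem_slitPlane_iff_arg.1 hs)
  have h1 : z.arg < Real.pi := by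
    rw [harg]; exact lt_of_le_of_ne (Complex.arg_le_pi _) hlt.1
  have h2 : -Real.pi < z.arg := Complex.neg_pi_lt_arg _
  have hz0 : z ≠ 0 := by
    rw [hz']
    exact mul_ne_zero (by exact_mod_cast (by positivity : (2 * Real.pi)⁻¹ ≠ 0)) hlt.2
  have key : eta s = Complex.exp ((Real.log ‖z‖ / 2 : ℝ) + (Real.pi / 4 + z.arg / 2 : ℝ) * Complex.I) := by
    rw [eta, ← hz, Complex.cpow_def_of_ne_zero hz0, ← Complex.exp_add, Complex.log]
    congr 1
    push_cast
    ring
  have : (eta s).arg = Real.pi / 4 + z.arg / 2 := by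
    rw [key, Complex.exp_add, ← Complex.ofReal_exp, Complex.arg_real_mul _ (Real.exp_pos _),
      Complex.arg_exp_mul_I, toIocMod_eq_self]
    constructor <;> linarith
  rw [this]
  constructor <;> linarith

theorem isClosed_G (α : ℝ) : IsClosed (G α) :=
  isClosed_le (by fun_prop) (by fun_prop)

end RiemannAux

end

/-!
Put `τ = 1 - s`. Since the integrand extends continuously by `0` to the origin when `Re s < -1`,
the line `0 ↙ 1` may be moved to the parallel line through `0`. On its two halves the integrand
differs by the factor `e^{πis}`, so `𝓡(s)` is `e^{πis} - 1` times an integral along a ray. Rotating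
the ray through the saddle `η` and substituting `x = ηv` turns it into
`∫₀^∞ e^{-τφ(v)} g(v) dv/v` with `φ(v) = (v² - 1)/2 - log v` and
`g(v) = e^{b(v-1)} / (1 - e^{2bv})`, where `b = πiη`.

By the same rotation `Γ(τ)` is an integral of this shape, with `2τ` for `τ` and `g = 1`. Hence the
quotient of `𝓡(s)` by `χ(s) η^{s-1} e^{πi(η-η²)}` is *exactly* a constant times the quotient of two
such integrals. Near the saddle `v = 1` the exponent is `-τ(v-1)² + b(v-1)`, so the integral equals
the Gaussian one `(π/τ)^{1/2} e^{b²/(4τ)}` up to `O(|τ|⁻¹)`, a relative error of order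
`|τ|^{-1/2} ≍ |η|⁻¹`. The constant is `e^{b²/(4τ)} = e^{-πi/8}`.
-/

namespace RiemannAux

open MeasureTheory Set Complex Topology
open scoped Real

section HorizontalLines

variable {E : Type*} [NormedAddCommGroup E] {g : ℝ → ℝ}

theorem integrable_of_eventually_norm_le_cocompact {f : ℝ → E} (hf : Continuous f)
    (hg : Integrable g) (hb : ∀ᶠ a : ℝ in cocompact ℝ, ‖f a‖ ≤ g a) : Integrable f :=
  hf.locallyIntegrable.integrable_of_isBigO_cocompact
    (.of_bound 1 <| hb.mono fun a ha => by simpa using ha.trans (le_abs_self (g a)))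
    (hg.integrableAtFilter _)

theorem integral_horizontal_line_eq [NormedSpace ℂ E] {H : ℂ → E} {y₁ y₂ : ℝ}
    (hc : ContinuousOn H {w | w.im ∈ uIcc y₁ y₂})
    (hd : DifferentiableOn ℂ H {w | w.im ∈ Ioo (min y₁ y₂) (max y₁ y₂)})
    (hg : Integrable g) (hg0 : Tendsto g (cocompact ℝ) (𝓝 0))
    (hb : ∀ᶠ a : ℝ in cocompact ℝ, ∀ y ∈ uIcc y₁ y₂, ‖H (a + y * I)‖ ≤ g a) :
    ∫ a : ℝ, H (a + y₁ * I) = ∫ a : ℝ, H (a + y₂ * I) := by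
  have horizontal : ∀ y ∈ uIcc y₁ y₂, Tendsto (fun R : ℝ => ∫ a in (-R)..R, H (a + y * I)) atTop
      (𝓝 (∫ a : ℝ, H (a + y * I))) := fun y hy =>
    intervalIntegral_tendsto_integral
      (integrable_of_eventually_norm_le_cocompact
        (hc.comp_continuous (by fun_prop) fun a => by simpa using hy) hg
        (hb.mono fun a ha => ha y hy))
      tendsto_neg_atTop_atBot tendsto_id
  have vertical : Tendsto (fun a : ℝ => I • ∫ y in y₁..y₂, H (a + y * I)) (cocompact ℝ) (𝓝 0) := by
    refine squeeze_zero_norm' (hb.mono fun a ha => ?_) (by simpa using hg0.mul_const |y₂ - y₁|)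
    rw [norm_smul, norm_I, one_mul]
    exact intervalIntegral.norm_integral_le_of_norm_le_const fun y hy => ha y (uIoc_subset_uIcc hy)
  have rectangle : ∀ R : ℝ, (∫ a in (-R)..R, H (a + y₁ * I)) - (∫ a in (-R)..R, H (a + y₂ * I)) +
      I • (∫ y in y₁..y₂, H (R + y * I)) - I • (∫ y in y₁..y₂, H ((-R : ℝ) + y * I)) = 0 :=
    fun R => integral_boundary_rect_eq_zero_of_continuousOn_of_differentiableOn H
      (⟨-R, y₁⟩ : ℂ) ⟨R, y₂⟩ (hc.mono fun w hw => hw.2) (hd.mono fun w hw => hw.2)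
  rw [cocompact_eq_atBot_atTop, tendsto_sup] at vertical
  have hlim := (((horizontal y₁ left_mem_uIcc).sub (horizontal y₂ right_mem_uIcc)).add
    vertical.2).sub (vertical.1.comp tendsto_neg_atTop_atBot)
  simp only [Function.comp_def, rectangle] at hlim
  simpa [sub_eq_zero] using tendsto_nhds_unique hlim tendsto_const_nhds

end HorizontalLines

theorem integrable_exp_neg_mul_abs {p : ℝ} (hp : 0 < p) :
    Integrable fun a : ℝ => Real.exp (-p * |a|) := by
  have h₁ : IntegrableOn (fun a : ℝ => Real.exp (-p * |a|)) (Iic 0) :=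
    (integrableOn_exp_mul_Iic hp 0).congr_fun
      (fun a (ha : a ≤ 0) => by simp only [abs_of_nonpos ha, neg_mul_neg]) measurableSet_Iic
  have h₂ : IntegrableOn (fun a : ℝ => Real.exp (-p * |a|)) (Ioi 0) :=
    (integrableOn_exp_mul_Ioi (neg_lt_zero.2 hp) 0).congr_fun
      (fun a (ha : 0 < a) => by simp only [abs_of_pos ha]) measurableSet_Ioi
  rw [← integrableOn_univ, ← Iic_union_Ioi]
  exact h₁.union h₂

theorem tendsto_exp_neg_mul_abs_cocompact {p : ℝ} (hp : 0 < p) :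
    Tendsto (fun a : ℝ => Real.exp (-p * |a|)) (cocompact ℝ) (𝓝 0) :=
  Real.tendsto_exp_atBot.comp
    ((tendsto_norm_cocompact_atTop (E := ℝ)).const_mul_atTop_of_neg (neg_lt_zero.2 hp))

theorem mul_sub_mul_exp_two_mul_le {p κ : ℝ} (hp : 0 < p) (hκ : 0 < κ) (a : ℝ) :
    p * a - κ * Real.exp (2 * a) ≤ p ^ 2 / (2 * κ) - p * |a| := by
  rcases le_total a 0 with ha | ha
  · rw [abs_of_nonpos ha]
    have : 0 ≤ κ * Real.exp (2 * a) := by positivity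
    have : 0 ≤ p ^ 2 / (2 * κ) := by positivity
    linarith
  · rw [abs_of_nonneg ha]
    have hexp : 2 * a ^ 2 ≤ Real.exp (2 * a) := by
      nlinarith [Real.quadratic_le_exp_of_nonneg (x := 2 * a) (by linarith)]
    have hsq : p ^ 2 / (2 * κ) + κ * (2 * a ^ 2) - 2 * p * a = 2 * κ * (a - p / (2 * κ)) ^ 2 := by
      field_simp
      ring
    have : 0 ≤ 2 * κ * (a - p / (2 * κ)) ^ 2 := by positivity
    nlinarith [mul_le_mul_of_nonneg_left hexp hκ.le]

-- In the variable `w = log x` this rotates, and rescales, a ray of integration in the `x`-plane.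
theorem integral_add_eq_integral_add_of_norm_le {E : Type*} [NormedAddCommGroup E]
    [NormedSpace ℂ E] {H : ℂ → E} {y₁ p κ C : ℝ} {w₀ : ℂ} (hp : 0 < p)
    (hκ : 0 < κ) (hC : 0 ≤ C) (hd : ∀ w : ℂ, w.im ∈ uIcc y₁ w₀.im → DifferentiableAt ℂ H w)
    (hb : ∀ w : ℂ, w.im ∈ uIcc y₁ w₀.im →
      ‖H w‖ ≤ C * Real.exp (p * w.re - κ * Real.exp (2 * w.re))) :
    ∫ a : ℝ, H (a + y₁ * I) = ∫ a : ℝ, H (a + w₀) := by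
  have htranslate : ∫ a : ℝ, H (a + w₀.im * I) = ∫ a : ℝ, H (a + w₀) := by
    rw [← integral_add_right_eq_self (fun a : ℝ => H (a + w₀.im * I)) w₀.re]
    simp only [ofReal_add, add_assoc, re_add_im]
  rw [← htranslate]
  set K := C * Real.exp (p ^ 2 / (2 * κ)) with hK
  refine integral_horizontal_line_eq (g := fun a => K * Real.exp (-p * |a|))
    (fun w hw => (hd w hw).continuousAt.continuousWithinAt)
    (fun w hw => (hd w (Ioo_subset_Icc_self hw)).differentiableWithinAt)
    ((integrable_exp_neg_mul_abs hp).const_mul K)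
    (by simpa using (tendsto_exp_neg_mul_abs_cocompact hp).const_mul K)
    (Eventually.of_forall fun (a : ℝ) y hy => ?_)
  calc ‖H (a + y * I)‖ ≤ C * Real.exp (p * a - κ * Real.exp (2 * a)) := by
        simpa using hb (a + y * I) (by simpa using hy)
    _ ≤ C * Real.exp (p ^ 2 / (2 * κ) - p * |a|) := by
        gcongr C * Real.exp ?_
        exact mul_sub_mul_exp_two_mul_le hp hκ a
    _ = K * Real.exp (-p * |a|) := by
        rw [hK, mul_assoc, ← Real.exp_add, sub_eq_add_neg, neg_mul]

theorem integral_Ioi_eq_integral_exp_smul {E : Type*} [NormedAddCommGroup E] [NormedSpace ℝ E]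
    (f : ℝ → E) : ∫ v in Ioi (0 : ℝ), f v = ∫ a : ℝ, Real.exp a • f (Real.exp a) := by
  simpa [Real.range_exp, abs_of_pos (Real.exp_pos _)] using
    integral_image_eq_integral_abs_deriv_smul MeasurableSet.univ
      (fun x _ => (Real.hasDerivAt_exp x).hasDerivWithinAt) Real.exp_injective.injOn f

section SaddlePoint

/-- The phase `φ` of the saddle point integrals `∫₀^∞ e^{-τφ(v)} g(v) dv/v`; its minimum on
`(0, ∞)` is `φ(1) = 0`. -/
noncomputable def phase (v : ℝ) : ℝ := (v ^ 2 - 1) / 2 - Real.log v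

theorem sq_div_two_le_phase {v : ℝ} (hv : 0 < v) : (v - 1) ^ 2 / 2 ≤ phase v := by
  have := Real.log_le_sub_one_of_pos hv
  unfold phase
  nlinarith

theorem continuousOn_phase : ContinuousOn phase (Ioi 0) :=
  (by fun_prop : Continuous fun v : ℝ => (v ^ 2 - 1) / 2).continuousOn.sub
    (Real.continuousOn_log.mono fun _ hv => (ne_of_gt hv : _ ≠ _))

theorem hasDerivAt_phase_sub_sq {v : ℝ} (hv : v ≠ 0) :
    HasDerivAt (fun v => phase v - (v - 1) ^ 2) (-((v - 1) ^ 2 / v)) v := by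
  refine (((((hasDerivAt_id v).pow 2).sub_const 1).div_const 2 |>.sub
    (Real.hasDerivAt_log hv)).sub (((hasDerivAt_id v).sub_const 1).pow 2)).congr_deriv ?_
  simp only [id_eq]
  field_simp
  ring

theorem abs_phase_sub_sq_le {v : ℝ} (hv : 1 / 2 ≤ v) :
    |phase v - (v - 1) ^ 2| ≤ 2 * |v - 1| ^ 3 := by
  have hderiv : ∀ u ∈ uIcc 1 v, ‖-((u - 1) ^ 2 / u)‖ ≤ 2 * |v - 1| ^ 2 := fun u hu => by
    have hu₀ : 1 / 2 ≤ u := (le_min (by norm_num) hv).trans hu.1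
    rw [norm_neg, norm_div, norm_pow, Real.norm_eq_abs, Real.norm_of_nonneg (by linarith),
      div_le_iff₀ (by linarith)]
    have := pow_le_pow_left₀ (abs_nonneg _) (abs_sub_left_of_mem_uIcc hu) 2
    nlinarith [sq_nonneg |v - 1|]
  have hmean := (convex_uIcc 1 v).norm_image_sub_le_of_norm_hasDerivWithin_le
    (fun u hu => (hasDerivAt_phase_sub_sq (by
      have := (le_min (by norm_num) hv : (1 / 2 : ℝ) ≤ min 1 v).trans hu.1
      linarith)).hasDerivWithinAt) hderiv left_mem_uIcc right_mem_uIcc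
  simpa [phase, pow_succ, mul_assoc] using hmean

theorem norm_exp_sub_exp_le {x y : ℂ} {m : ℝ} (hx : x.re ≤ m) (hy : y.re ≤ m) :
    ‖exp x - exp y‖ ≤ Real.exp m * ‖x - y‖ :=
  (convex_halfSpace_re_le m).norm_image_sub_le_of_norm_deriv_le
    (fun _ _ => differentiableAt_exp)
    (fun u hu => by rw [Complex.deriv_exp, norm_exp]; exact Real.exp_le_exp.2 hu) hy hx

/-- The function `(1 + z + z³) e^{Bz - cz²/2}` that dominates the error in replacing a saddle point
integrand by a Gaussian, as a function of the scaled distance `z` to the saddle. -/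
noncomputable def weight (B c z : ℝ) : ℝ :=
  (1 + z + z ^ 3) * (Real.exp (B * z) * Real.exp (-(c * z ^ 2 / 2)))

theorem weight_le {B c z : ℝ} (hc : 0 < c) (hz : 0 ≤ z) :
    weight B c z ≤ 8 * Real.exp ((B + 1) ^ 2 / c) * Real.exp (-(c / 4 * z ^ 2)) := by
  have hpoly : 1 + z + z ^ 3 ≤ 8 * Real.exp z := by
    have h₃ := Real.pow_div_factorial_le_exp z hz 3
    norm_num [Nat.factorial] at h₃
    linarith [Real.add_one_le_exp z]
  have hsq : z + B * z - c * z ^ 2 / 2 ≤ (B + 1) ^ 2 / c - c / 4 * z ^ 2 := by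
    have : 0 ≤ c / 4 * (2 * (B + 1) / c - z) ^ 2 := by positivity
    have e : c / 4 * (2 * (B + 1) / c - z) ^ 2
        = (B + 1) ^ 2 / c - c / 4 * z ^ 2 - (z + B * z - c * z ^ 2 / 2) := by
      field_simp
      ring
    linarith
  calc weight B c z ≤ 8 * Real.exp z * (Real.exp (B * z) * Real.exp (-(c * z ^ 2 / 2))) := by
        unfold weight
        gcongr
    _ = 8 * Real.exp (z + B * z - c * z ^ 2 / 2) := by
        rw [sub_eq_add_neg, Real.exp_add, Real.exp_add]
        ring
    _ ≤ 8 * Real.exp ((B + 1) ^ 2 / c - c / 4 * z ^ 2) := by gcongr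
    _ = _ := by rw [sub_eq_add_neg, Real.exp_add, mul_assoc]

/-- The distance from `v` to the saddle `1` in units of the width `‖τ‖^{-1/2}` of the peak of
`e^{-τφ}`. -/
noncomputable def saddleDist (τ : ℂ) (v : ℝ) : ℝ := √‖τ‖ * |v - 1|

theorem saddleDist_nonneg (τ : ℂ) (v : ℝ) : 0 ≤ saddleDist τ v := by
  unfold saddleDist
  positivity

theorem saddleDist_sq (τ : ℂ) (v : ℝ) : saddleDist τ v ^ 2 = ‖τ‖ * (v - 1) ^ 2 := by
  rw [saddleDist, mul_pow, Real.sq_sqrt (norm_nonneg _), sq_abs]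

/-- The hypotheses of the saddle point estimate on the amplitude `g`: it is close to the exponential
`e^{b(v-1)}` for `v ≥ 1/2`, and has at most a simple pole at `0`. -/
structure IsAmplitude (B : ℝ) (τ b : ℂ) (g : ℝ → ℂ) : Prop where
  continuousOn : ContinuousOn g (Ioi 0)
  norm_le : ‖b‖ ≤ B * √‖τ‖
  near : ∀ v, 1 / 2 ≤ v →
    ‖g v - exp (b * (v - 1 : ℝ))‖ ≤ B / √‖τ‖ * Real.exp (B * saddleDist τ v)
  origin : ∀ v, 0 < v → v < 1 / 2 → ‖g v‖ ≤ B / v * Real.exp (B * saddleDist τ v)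

/-- The integral `∫₀^∞ e^{-τφ(v)} g(v) dv/v`. -/
noncomputable def saddleIntegral (τ : ℂ) (g : ℝ → ℂ) : ℂ :=
  ∫ v in Ioi (0 : ℝ), exp (-τ * phase v) * (g v / v)

variable {τ b : ℂ} {g : ℝ → ℂ} {B c v : ℝ}

theorem norm_exp_mul_sub_one_le (hb : ‖b‖ ≤ B * √‖τ‖) (v : ℝ) :
    ‖exp (b * (v - 1 : ℝ))‖ ≤ Real.exp (B * saddleDist τ v) := by
  refine (norm_exp_le_exp_norm _).trans (Real.exp_le_exp.2 ?_)
  rw [norm_mul, norm_real, Real.norm_eq_abs, saddleDist, ← mul_assoc]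
  gcongr

theorem re_neg_mul_sq_le (hcτ : c * ‖τ‖ ≤ τ.re) (v : ℝ) :
    (-τ * ((v - 1) ^ 2 : ℝ)).re ≤ -(c * saddleDist τ v ^ 2) := by
  rw [re_mul_ofReal, neg_re, neg_mul, saddleDist_sq, ← mul_assoc]
  gcongr

theorem re_neg_mul_phase_le (hτ : 0 ≤ τ.re) (hcτ : c * ‖τ‖ ≤ τ.re) (hv : 0 < v) :
    (-τ * phase v).re ≤ -(c * saddleDist τ v ^ 2 / 2) := by
  rw [re_mul_ofReal, neg_re, neg_mul, saddleDist_sq, neg_le_neg_iff]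
  nlinarith [mul_le_mul_of_nonneg_left (sq_div_two_le_phase hv) hτ,
    mul_le_mul_of_nonneg_right hcτ (sq_nonneg (v - 1))]

theorem exp_mul_exp_le_weight (hτ : τ ≠ 0) (hv : 1 / 2 ≤ |v - 1|) :
    Real.exp (B * saddleDist τ v) * Real.exp (-(c * saddleDist τ v ^ 2 / 2)) ≤
      2 * (√‖τ‖)⁻¹ * weight B c (saddleDist τ v) := by
  have : 0 < √‖τ‖ := Real.sqrt_pos.2 (norm_pos_iff.2 hτ)
  have hz := saddleDist_nonneg τ v
  have hone : 1 ≤ 2 * (√‖τ‖)⁻¹ * (1 + saddleDist τ v + saddleDist τ v ^ 3) := by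
    have : 2 * (√‖τ‖)⁻¹ * saddleDist τ v = 2 * |v - 1| := by
      unfold saddleDist
      field_simp
    have : 0 ≤ 2 * (√‖τ‖)⁻¹ * (1 + saddleDist τ v ^ 3) := by positivity
    linarith
  unfold weight
  rw [← mul_assoc]
  exact le_mul_of_one_le_left (by positivity) hone

theorem norm_exp_neg_mul_sq_add_le (hc : 0 ≤ c) (hτ : τ ≠ 0) (hcτ : c * ‖τ‖ ≤ τ.re)
    (hb : ‖b‖ ≤ B * √‖τ‖) (hv : 1 / 2 ≤ |v - 1|) :
    ‖exp (-τ * ((v - 1) ^ 2 : ℝ) + b * (v - 1 : ℝ))‖ ≤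
      2 * (√‖τ‖)⁻¹ * weight B c (saddleDist τ v) := by
  refine le_trans ?_ (exp_mul_exp_le_weight hτ hv)
  rw [exp_add, mul_comm, norm_mul, norm_exp (-τ * _)]
  gcongr
  · exact norm_exp_mul_sub_one_le hb v
  · refine (re_neg_mul_sq_le hcτ v).trans ?_
    nlinarith [mul_nonneg hc (sq_nonneg (saddleDist τ v))]

theorem norm_exp_neg_mul_phase_sub_le (hc : 0 ≤ c) (hτ : τ ≠ 0) (hcτ : c * ‖τ‖ ≤ τ.re)
    (hv : 1 / 2 ≤ v) :
    ‖exp (-τ * phase v) - exp (-τ * ((v - 1) ^ 2 : ℝ))‖ ≤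
      2 * (√‖τ‖)⁻¹ * saddleDist τ v ^ 3 * Real.exp (-(c * saddleDist τ v ^ 2 / 2)) := by
  have hre : 0 ≤ τ.re := (mul_nonneg hc (norm_nonneg τ)).trans hcτ
  have : 0 < √‖τ‖ := Real.sqrt_pos.2 (norm_pos_iff.2 hτ)
  have hsq : (-τ * ((v - 1) ^ 2 : ℝ)).re ≤ -(c * saddleDist τ v ^ 2 / 2) :=
    (re_neg_mul_sq_le hcτ v).trans (by nlinarith [mul_nonneg hc (sq_nonneg (saddleDist τ v))])
  calc ‖exp (-τ * phase v) - exp (-τ * ((v - 1) ^ 2 : ℝ))‖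
      ≤ Real.exp (-(c * saddleDist τ v ^ 2 / 2)) * (‖τ‖ * |phase v - (v - 1) ^ 2|) := by
        refine (norm_exp_sub_exp_le (re_neg_mul_phase_le hre hcτ (by linarith)) hsq).trans_eq ?_
        rw [← mul_sub, ← ofReal_sub, norm_mul, norm_neg, norm_real, Real.norm_eq_abs]
    _ ≤ Real.exp (-(c * saddleDist τ v ^ 2 / 2)) * (‖τ‖ * (2 * |v - 1| ^ 3)) := by
        gcongr
        exact abs_phase_sub_sq_le hv
    _ = _ := by
        conv_lhs => rw [← Real.sq_sqrt (norm_nonneg τ)]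
        unfold saddleDist
        field_simp

theorem IsAmplitude.nonneg (hτ : τ ≠ 0) (hg : IsAmplitude B τ b g) : 0 ≤ B :=
  nonneg_of_mul_nonneg_left ((norm_nonneg b).trans hg.norm_le)
    (Real.sqrt_pos.2 (norm_pos_iff.2 hτ))

theorem IsAmplitude.norm_div_le (hτ : 1 ≤ ‖τ‖) (hg : IsAmplitude B τ b g) (hv : 1 / 2 ≤ v) :
    ‖g v / v‖ ≤ 2 * (1 + B) * Real.exp (B * saddleDist τ v) := by
  have hB := hg.nonneg (norm_pos_iff.1 (by linarith))
  have hg_norm : ‖g v‖ ≤ (1 + B) * Real.exp (B * saddleDist τ v) :=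
    calc ‖g v‖ ≤ ‖exp (b * (v - 1 : ℝ))‖ + ‖g v - exp (b * (v - 1 : ℝ))‖ := norm_le_insert' _ _
      _ ≤ Real.exp (B * saddleDist τ v) + B * Real.exp (B * saddleDist τ v) := by
        gcongr
        · exact norm_exp_mul_sub_one_le hg.norm_le v
        · exact (hg.near v hv).trans
            (mul_le_mul_of_nonneg_right (div_le_self hB (Real.one_le_sqrt.2 hτ)) (by positivity))
      _ = _ := by ring
  rw [norm_div, norm_real, Real.norm_of_nonneg (by linarith), div_le_iff₀ (by linarith)]
  have : 0 ≤ (1 + B) * Real.exp (B * saddleDist τ v) := by positivity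
  nlinarith

theorem IsAmplitude.norm_div_sub_le (hτ : τ ≠ 0) (hg : IsAmplitude B τ b g) (hv : 1 / 2 ≤ v) :
    ‖g v / v - exp (b * (v - 1 : ℝ))‖ ≤
      2 * (√‖τ‖)⁻¹ * (B + saddleDist τ v) * Real.exp (B * saddleDist τ v) := by
  have hv₀ : 0 < v := by linarith
  have : 0 < √‖τ‖ := Real.sqrt_pos.2 (norm_pos_iff.2 hτ)
  have hsplit : g v / v - exp (b * (v - 1 : ℝ)) =
      ((g v - exp (b * (v - 1 : ℝ))) - (v - 1 : ℝ) * exp (b * (v - 1 : ℝ))) / v := by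
    have : (v : ℂ) ≠ 0 := ofReal_ne_zero.2 hv₀.ne'
    field_simp
    push_cast
    ring
  have hnum : ‖(g v - exp (b * (v - 1 : ℝ))) - (v - 1 : ℝ) * exp (b * (v - 1 : ℝ))‖ ≤
      (√‖τ‖)⁻¹ * (B + saddleDist τ v) * Real.exp (B * saddleDist τ v) :=
    calc _ ≤ B / √‖τ‖ * Real.exp (B * saddleDist τ v)
          + |v - 1| * Real.exp (B * saddleDist τ v) := by
          refine (norm_sub_le _ _).trans (add_le_add (hg.near v hv) ?_)
          rw [norm_mul, norm_real, Real.norm_eq_abs]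
          gcongr
          exact norm_exp_mul_sub_one_le hg.norm_le v
      _ = (√‖τ‖)⁻¹ * (B + saddleDist τ v) * Real.exp (B * saddleDist τ v) := by
          generalize Real.exp (B * saddleDist τ v) = E
          unfold saddleDist
          field_simp
  rw [hsplit, norm_div, norm_real, Real.norm_of_nonneg hv₀.le, div_le_iff₀ hv₀]
  refine hnum.trans ?_
  nlinarith [(norm_nonneg _).trans hnum]

theorem IsAmplitude.norm_sub_gaussian_le_of_half_le (hg : IsAmplitude B τ b g) (hc : 0 ≤ c)
    (hτ : 1 ≤ ‖τ‖) (hcτ : c * ‖τ‖ ≤ τ.re) (hv : 1 / 2 ≤ v) :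
    ‖exp (-τ * phase v) * (g v / v) - exp (-τ * ((v - 1) ^ 2 : ℝ) + b * (v - 1 : ℝ))‖ ≤
      4 * (1 + B) * (√‖τ‖)⁻¹ * weight B c (saddleDist τ v) := by
  have hτ₀ : τ ≠ 0 := norm_pos_iff.1 (by linarith)
  have hB := hg.nonneg hτ₀
  have hz := saddleDist_nonneg τ v
  have hsq : ‖exp (-τ * ((v - 1) ^ 2 : ℝ))‖ ≤ Real.exp (-(c * saddleDist τ v ^ 2 / 2)) := by
    rw [norm_exp, Real.exp_le_exp]
    exact (re_neg_mul_sq_le hcτ v).trans (by nlinarith [mul_nonneg hc (sq_nonneg (saddleDist τ v))])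
  have hsplit : exp (-τ * phase v) * (g v / v) - exp (-τ * ((v - 1) ^ 2 : ℝ) + b * (v - 1 : ℝ)) =
      (exp (-τ * phase v) - exp (-τ * ((v - 1) ^ 2 : ℝ))) * (g v / v)
        + exp (-τ * ((v - 1) ^ 2 : ℝ)) * (g v / v - exp (b * (v - 1 : ℝ))) := by
    rw [exp_add]
    ring
  set z := saddleDist τ v
  calc _ ≤ 2 * (√‖τ‖)⁻¹ * z ^ 3 * Real.exp (-(c * z ^ 2 / 2)) * (2 * (1 + B) * Real.exp (B * z))
        + Real.exp (-(c * z ^ 2 / 2)) * (2 * (√‖τ‖)⁻¹ * (B + z) * Real.exp (B * z)) := by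
        rw [hsplit]
        refine (norm_add_le _ _).trans ?_
        rw [norm_mul, norm_mul]
        gcongr
        · exact norm_exp_neg_mul_phase_sub_le hc hτ₀ hcτ hv
        · exact hg.norm_div_le hτ hv
        · exact hg.norm_div_sub_le hτ₀ hv
    _ = (4 * (1 + B) * z ^ 3 + 2 * (B + z)) * ((√‖τ‖)⁻¹ * (Real.exp (B * z) *
          Real.exp (-(c * z ^ 2 / 2)))) := by ring
    _ ≤ 4 * (1 + B) * (1 + z + z ^ 3) * ((√‖τ‖)⁻¹ * (Real.exp (B * z) *
          Real.exp (-(c * z ^ 2 / 2)))) := by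
        gcongr
        nlinarith [mul_nonneg hB hz]
    _ = 4 * (1 + B) * (√‖τ‖)⁻¹ * weight B c z := by
        unfold weight
        ring

theorem norm_exp_neg_mul_phase_le_sq (hτ : 2 ≤ τ.re) (hcτ : c * ‖τ‖ ≤ τ.re) (hv : 0 < v) :
    ‖exp (-τ * phase v)‖ ≤ 8 * v ^ 2 * Real.exp (-(c * saddleDist τ v ^ 2 / 2)) := by
  have hexp : Real.exp (2 * Real.log v) = v ^ 2 := by
    rw [two_mul, Real.exp_add, Real.exp_log hv, sq]
  have he : Real.exp 2 ≤ 8 := by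
    rw [show (2 : ℝ) = 1 + 1 by norm_num, Real.exp_add]
    nlinarith [Real.exp_one_lt_d9, Real.exp_pos 1]
  have hre : (-τ * phase v).re ≤ 2 + 2 * Real.log v + -(c * saddleDist τ v ^ 2 / 2) := by
    rw [re_mul_ofReal, neg_re, saddleDist_sq]
    have hphase : 2 * phase v = v ^ 2 - 1 - 2 * Real.log v := by
      unfold phase
      ring
    nlinarith [mul_le_mul_of_nonneg_left (sq_div_two_le_phase hv) (sub_nonneg.2 hτ),
      mul_le_mul_of_nonneg_right hcτ (sq_nonneg (v - 1))]
  calc ‖exp (-τ * phase v)‖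
      ≤ Real.exp (2 + 2 * Real.log v + -(c * saddleDist τ v ^ 2 / 2)) := by
        rw [norm_exp]
        exact Real.exp_le_exp.2 hre
    _ = Real.exp 2 * v ^ 2 * Real.exp (-(c * saddleDist τ v ^ 2 / 2)) := by
        rw [Real.exp_add, Real.exp_add, hexp]
    _ ≤ _ := by gcongr

theorem IsAmplitude.norm_mul_le_of_lt_half (hg : IsAmplitude B τ b g) (hτ : 2 ≤ τ.re)
    (hcτ : c * ‖τ‖ ≤ τ.re) (hv₀ : 0 < v) (hv : v < 1 / 2) :
    ‖exp (-τ * phase v) * (g v / v)‖ ≤ 16 * B * (√‖τ‖)⁻¹ * weight B c (saddleDist τ v) := by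
  have hτ₀ : τ ≠ 0 := norm_pos_iff.1 (by linarith [re_le_norm τ])
  have hB := hg.nonneg hτ₀
  have hdist : 1 / 2 ≤ |v - 1| := by
    rw [abs_of_nonpos (by linarith)]
    linarith
  calc ‖exp (-τ * phase v) * (g v / v)‖
      ≤ 8 * v ^ 2 * Real.exp (-(c * saddleDist τ v ^ 2 / 2)) *
          (B / v * Real.exp (B * saddleDist τ v) / v) := by
        rw [norm_mul, norm_div, norm_real, Real.norm_of_nonneg hv₀.le]
        gcongr
        · exact norm_exp_neg_mul_phase_le_sq hτ hcτ hv₀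
        · exact hg.origin v hv₀ hv
    _ = 8 * B * (Real.exp (B * saddleDist τ v) * Real.exp (-(c * saddleDist τ v ^ 2 / 2))) := by
        field_simp
    _ ≤ 8 * B * (2 * (√‖τ‖)⁻¹ * weight B c (saddleDist τ v)) := by
        gcongr 8 * B * ?_
        exact exp_mul_exp_le_weight hτ₀ hdist
    _ = _ := by ring

theorem IsAmplitude.norm_indicator_sub_gaussian_le (hg : IsAmplitude B τ b g) (hc : 0 ≤ c)
    (hτ : 2 ≤ τ.re) (hcτ : c * ‖τ‖ ≤ τ.re) (v : ℝ) :
    ‖(Ioi (0 : ℝ)).indicator (fun v => exp (-τ * phase v) * (g v / v)) v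
        - exp (-τ * ((v - 1) ^ 2 : ℝ) + b * (v - 1 : ℝ))‖ ≤
      16 * (1 + B) * (√‖τ‖)⁻¹ * weight B c (saddleDist τ v) := by
  have hτ₁ : 1 ≤ ‖τ‖ := by linarith [re_le_norm τ]
  have hτ₀ : τ ≠ 0 := norm_pos_iff.1 (by linarith)
  have hB := hg.nonneg hτ₀
  have hW : 0 ≤ (√‖τ‖)⁻¹ * weight B c (saddleDist τ v) := by
    have := saddleDist_nonneg τ v
    unfold weight
    positivity
  have hBW := mul_nonneg hB hW
  rcases le_or_gt v 0 with hv | hv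
  · have hdist : 1 / 2 ≤ |v - 1| := by
      rw [abs_of_neg (by linarith)]
      linarith
    rw [indicator_of_notMem (notMem_Ioi.2 hv), zero_sub, norm_neg]
    linarith [norm_exp_neg_mul_sq_add_le hc hτ₀ hcτ hg.norm_le hdist]
  rw [indicator_of_mem (mem_Ioi.2 hv)]
  rcases lt_or_ge v (1 / 2) with hv' | hv'
  · have hdist : 1 / 2 ≤ |v - 1| := by
      rw [abs_of_neg (by linarith)]
      linarith
    linarith [norm_sub_le (exp (-τ * phase v) * (g v / v))
        (exp (-τ * ((v - 1) ^ 2 : ℝ) + b * (v - 1 : ℝ))),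
      hg.norm_mul_le_of_lt_half hτ hcτ hv hv',
      norm_exp_neg_mul_sq_add_le hc hτ₀ hcτ hg.norm_le hdist]
  · linarith [hg.norm_sub_gaussian_le_of_half_le hc hτ₁ hcτ hv']

theorem integrable_cexp_neg_mul_sq_add (hτ : 0 < τ.re) (b : ℂ) :
    Integrable fun v : ℝ => exp (-τ * ((v - 1) ^ 2 : ℝ) + b * (v - 1 : ℝ)) := by
  simpa using (integrable_cexp_quadratic hτ b 0).comp_sub_right 1

theorem integral_cexp_neg_mul_sq_add (hτ : 0 < τ.re) (b : ℂ) :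
    ∫ v : ℝ, exp (-τ * ((v - 1) ^ 2 : ℝ) + b * (v - 1 : ℝ)) =
      (π / τ) ^ (1 / 2 : ℂ) * exp (b ^ 2 / (4 * τ)) := by
  have hshift := integral_sub_right_eq_self (fun x : ℝ => exp (-τ * (x ^ 2 : ℝ) + b * x)) 1
    (μ := volume)
  have hgauss := integral_cexp_quadratic (b := -τ) (by simpa using hτ) b 0
  rw [hshift]
  simpa [div_neg, neg_div] using hgauss

theorem IsAmplitude.aestronglyMeasurable_indicator (hg : IsAmplitude B τ b g) :
    AEStronglyMeasurable
      ((Ioi (0 : ℝ)).indicator fun v => exp (-τ * phase v) * (g v / v)) := by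
  rw [aestronglyMeasurable_indicator_iff measurableSet_Ioi]
  refine ContinuousOn.aestronglyMeasurable (.mul ?_ (hg.continuousOn.div (by fun_prop) ?_))
    measurableSet_Ioi
  · exact continuous_exp.comp_continuousOn
      (continuousOn_const.mul (continuous_ofReal.comp_continuousOn continuousOn_phase))
  · exact fun v hv => ofReal_ne_zero.2 (ne_of_gt hv)

theorem integral_gaussian_saddleDist (hc : 0 < c) (hτ : τ ≠ 0) :
    ∫ v : ℝ, Real.exp (-(c / 4 * saddleDist τ v ^ 2)) = √(4 * π / c) * (√‖τ‖)⁻¹ := by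
  have h := integral_sub_right_eq_self (fun x : ℝ => Real.exp (-(c * ‖τ‖ / 4) * x ^ 2)) 1
    (μ := volume)
  have hsqrt : √(π / (c * ‖τ‖ / 4)) = √(4 * π / c) * (√‖τ‖)⁻¹ := by
    rw [← Real.sqrt_inv, ← Real.sqrt_mul (by positivity)]
    congr 1
    field_simp
  rw [integral_gaussian, hsqrt] at h
  rw [← h]
  congr with v
  rw [saddleDist_sq]
  ring_nf

theorem IsAmplitude.norm_saddleIntegral_sub_le (hg : IsAmplitude B τ b g) (hc : 0 < c)
    (hτ : 2 ≤ τ.re) (hcτ : c * ‖τ‖ ≤ τ.re) :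
    ‖saddleIntegral τ g - (π / τ) ^ (1 / 2 : ℂ) * exp (b ^ 2 / (4 * τ))‖ ≤
      128 * (1 + B) * Real.exp ((B + 1) ^ 2 / c) * √(4 * π / c) * ‖τ‖⁻¹ := by
  have hre : 0 < τ.re := by linarith
  have hτ₀ : 0 < ‖τ‖ := hre.trans_le (re_le_norm τ)
  have hB := hg.nonneg (norm_pos_iff.1 hτ₀)
  set F := (Ioi (0 : ℝ)).indicator fun v => exp (-τ * phase v) * (g v / v)
  set q : ℝ → ℂ := fun v => exp (-τ * ((v - 1) ^ 2 : ℝ) + b * (v - 1 : ℝ))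
  set K := 128 * (1 + B) * Real.exp ((B + 1) ^ 2 / c) with hK
  have hbound : ∀ v, ‖F v - q v‖ ≤ K * (√‖τ‖)⁻¹ * Real.exp (-(c / 4 * saddleDist τ v ^ 2)) :=
    fun v => calc
      ‖F v - q v‖ ≤ 16 * (1 + B) * (√‖τ‖)⁻¹ * weight B c (saddleDist τ v) :=
        hg.norm_indicator_sub_gaussian_le hc.le hτ hcτ v
      _ ≤ 16 * (1 + B) * (√‖τ‖)⁻¹ *
          (8 * Real.exp ((B + 1) ^ 2 / c) * Real.exp (-(c / 4 * saddleDist τ v ^ 2))) := by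
        gcongr
        exact weight_le hc (saddleDist_nonneg τ v)
      _ = _ := by
        rw [hK]
        ring
  have hgauss : Integrable fun v => K * (√‖τ‖)⁻¹ * Real.exp (-(c / 4 * saddleDist τ v ^ 2)) := by
    refine (Integrable.of_integral_ne_zero ?_).const_mul _
    rw [integral_gaussian_saddleDist hc (norm_pos_iff.1 hτ₀)]
    positivity
  have hq : Integrable q := integrable_cexp_neg_mul_sq_add hre b
  have hF : Integrable F := by
    have := (hgauss.mono' (hg.aestronglyMeasurable_indicator.sub hq.aestronglyMeasurable)
      (ae_of_all _ hbound)).add hq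
    simpa only [Pi.add_def, Pi.sub_apply, sub_add_cancel] using this
  rw [saddleIntegral, ← integral_indicator measurableSet_Ioi,
    ← integral_cexp_neg_mul_sq_add hre b, ← integral_sub hF hq]
  refine (norm_integral_le_of_norm_le hgauss (ae_of_all _ hbound)).trans_eq ?_
  rw [integral_const_mul, integral_gaussian_saddleDist hc (norm_pos_iff.1 hτ₀)]
  nth_rw 3 [← Real.mul_self_sqrt hτ₀.le]
  rw [mul_inv]
  ring

end SaddlePoint

theorem saddleIntegral_eq_integral_exp (τ : ℂ) (g : ℝ → ℂ) :
    saddleIntegral τ g =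
      ∫ a : ℝ, exp (τ * a - τ * exp (2 * a) / 2 + τ / 2) * g (Real.exp a) := by
  rw [saddleIntegral, integral_Ioi_eq_integral_exp_smul]
  congr with a
  have hphase : -τ * phase (Real.exp a) = τ * a - τ * exp (2 * a) / 2 + τ / 2 := by
    rw [phase, Real.log_exp, ← Real.exp_nat_mul]
    push_cast
    ring
  rw [hphase, real_smul]
  field_simp [ofReal_ne_zero.2 (Real.exp_ne_zero a)]

section Gamma

variable {τ : ℂ}

theorem Gamma_eq_two_mul_integral_exp (hτ : 0 < τ.re) :
    Gamma τ = 2 * ∫ a : ℝ, exp (2 * τ * a - exp (2 * a)) := by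
  rw [Complex.Gamma_eq_integral hτ, GammaIntegral, ← integral_comp_rpow_Ioi_of_pos two_pos,
    integral_Ioi_eq_integral_exp_smul, ← integral_const_mul]
  congr with a
  have hsq : Real.exp a ^ (2 : ℝ) = Real.exp (2 * a) := by rw [← Real.exp_mul, mul_comm]
  have hpow : ((Real.exp (2 * a) : ℝ) : ℂ) ^ (τ - 1) = exp (2 * a * (τ - 1)) := by
    rw [cpow_def_of_ne_zero (ofReal_ne_zero.2 (Real.exp_ne_zero _)), ← ofReal_log (by positivity),
      Real.log_exp]
    push_cast
    rfl
  have hexp : exp (2 * τ * a - exp (2 * a)) =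
      exp a * (exp a * (exp (-exp (2 * a)) * exp (2 * a * (τ - 1)))) := by
    simp only [← exp_add]
    ring_nf
  rw [hexp, show (2 : ℝ) - 1 = 1 by norm_num, Real.rpow_one, hsq, hpow]
  simp only [real_smul, ofReal_exp, ofReal_mul, ofReal_neg, ofReal_ofNat]
  ring

theorem norm_exp_two_mul_sub_exp_le {w : ℂ} (hw : |w.im| ≤ |τ.arg| / 2) :
    ‖exp (2 * τ * w - exp (2 * w))‖ ≤ Real.exp (2 * |τ.im| * π) *
      Real.exp (2 * τ.re * w.re - Real.cos τ.arg * Real.exp (2 * w.re)) := by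
  have hcos : Real.cos τ.arg ≤ Real.cos (2 * w.im) := by
    rw [← Real.cos_abs, ← Real.cos_abs (2 * w.im), abs_mul, abs_two]
    exact Real.cos_le_cos_of_nonneg_of_le_pi (by positivity) (abs_arg_le_pi τ) (by linarith)
  have him : -(τ.im * w.im) ≤ |τ.im| * π := by
    refine (neg_le_abs _).trans ?_
    rw [abs_mul]
    gcongr
    linarith [abs_arg_le_pi τ, abs_nonneg τ.arg]
  have hre : (2 * τ * w - exp (2 * w)).re =
      2 * τ.re * w.re - 2 * (τ.im * w.im) - Real.exp (2 * w.re) * Real.cos (2 * w.im) := by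
    simp only [sub_re, mul_re, mul_im, re_ofNat, im_ofNat, zero_mul, sub_zero, add_zero, exp_re]
    ring
  rw [norm_exp, ← Real.exp_add, hre, Real.exp_le_exp]
  nlinarith [mul_le_mul_of_nonneg_left hcos (Real.exp_pos (2 * w.re)).le]

theorem integral_exp_eq_integral_exp_add_log (hτ : 0 < τ.re) :
    ∫ a : ℝ, exp (2 * τ * a - exp (2 * a)) =
      ∫ a : ℝ, exp (2 * τ * (a + log τ / 2) - τ * exp (2 * a)) := by
  have hτ₀ : τ ≠ 0 := fun h => by simp [h] at hτ
  have him : (log τ / 2).im = τ.arg / 2 := by rw [div_ofNat_im, log_im]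
  have hrot := integral_add_eq_integral_add_of_norm_le (H := fun w => exp (2 * τ * w - exp (2 * w)))
    (y₁ := 0) (w₀ := log τ / 2) (p := 2 * τ.re) (by positivity)
    (Real.cos_pos_of_mem_Ioo (abs_lt.1 (abs_arg_lt_pi_div_two_iff.2 (Or.inl hτ))))
    (Real.exp_pos (2 * |τ.im| * π)).le (fun w _ => by fun_prop) fun w hw => by
      have := abs_sub_left_of_mem_uIcc hw
      rw [him, sub_zero, sub_zero, abs_div, abs_two] at this
      exact norm_exp_two_mul_sub_exp_le this
  simpa [mul_add, mul_div_cancel₀, exp_add, exp_log hτ₀, mul_comm] using hrot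

theorem Gamma_eq_saddleIntegral (hτ : 0 < τ.re) :
    Gamma τ = 2 * exp (τ * log τ - τ) * saddleIntegral (2 * τ) 1 := by
  rw [Gamma_eq_two_mul_integral_exp hτ, integral_exp_eq_integral_exp_add_log hτ, mul_assoc,
    saddleIntegral_eq_integral_exp, ← integral_const_mul (exp _)]
  congr with a
  rw [Pi.one_apply, mul_one, ← exp_add]
  ring_nf

end Gamma

section Integrand

variable {s x : ℂ}

theorem exp_sub_exp_neg_eq_sin (x : ℂ) :
    exp (π * I * x) - exp (-(π * I * x)) = 2 * I * sin (π * x) := by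
  rw [sin, show π * I * x = π * x * I by ring, neg_mul]
  linear_combination (exp (π * x * I) - exp (-(π * x * I))) * I_sq

theorem abs_im_le_norm_sin (z : ℂ) : |z.im| ≤ ‖sin z‖ := by
  have hsinh : |z.im| ≤ |Real.sinh z.im| := by
    rw [Real.abs_sinh, Real.self_le_sinh_iff]
    exact abs_nonneg _
  have hnorm := abs_norm_sub_norm_le (exp (-z * I)) (exp (z * I))
  rw [norm_exp, norm_exp, neg_mul, neg_re, mul_I_re, neg_neg] at hnorm
  rw [sin, norm_div, norm_mul, norm_I, mul_one, neg_mul, RCLike.norm_ofNat]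
  rw [Real.sinh_eq, abs_div, abs_two] at hsinh
  linarith

theorem two_pi_mul_abs_im_le_norm (x : ℂ) :
    2 * π * |x.im| ≤ ‖exp (π * I * x) - exp (-(π * I * x))‖ := by
  have := abs_im_le_norm_sin (π * x)
  rw [im_ofReal_mul, abs_mul, abs_of_pos Real.pi_pos] at this
  rw [exp_sub_exp_neg_eq_sin, norm_mul, norm_mul, norm_I, mul_one, RCLike.norm_ofNat]
  linarith

theorem mem_slitPlane_of_re_sub_im_nonneg (hx : 0 ≤ x.re - x.im) (hx₀ : x ≠ 0) :
    x ∈ slitPlane := by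
  by_contra h
  rw [mem_slitPlane_iff, not_or, not_lt, not_not] at h
  exact hx₀ (Complex.ext (by rw [zero_re]; linarith [h.1, h.2]) h.2)

theorem exp_sub_exp_neg_ne_zero (hx : x.re - x.im ∈ Ico 0 1) (hx₀ : x ≠ 0) :
    exp (π * I * x) - exp (-(π * I * x)) ≠ 0 := by
  rw [exp_sub_exp_neg_eq_sin]
  refine mul_ne_zero (by simp) fun h => ?_
  obtain ⟨n, hn⟩ := Complex.sin_eq_zero_iff.1 h
  have hxn : x = n := mul_left_cancel₀ (ofReal_ne_zero.2 Real.pi_ne_zero) (by rw [hn, mul_comm])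
  rw [hxn, intCast_re, intCast_im, sub_zero] at hx
  have hn₀ : n = 0 := le_antisymm (Int.lt_add_one_iff.1 (by exact_mod_cast hx.2))
    (by exact_mod_cast hx.1)
  exact hx₀ (by rw [hxn, hn₀, Int.cast_zero])

theorem differentiableAt_integrand (s : ℂ) (hx : x.re - x.im ∈ Ico 0 1) (hx₀ : x ≠ 0) :
    DifferentiableAt ℂ (integrand s) x := by
  unfold integrand
  exact ((differentiableAt_id.cpow_const (mem_slitPlane_of_re_sub_im_nonneg hx.1 hx₀)).mul
    (by fun_prop)).div (by fun_prop) (exp_sub_exp_neg_ne_zero hx hx₀)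

theorem continuousAt_integrand_zero (hs : s.re < -1) : ContinuousAt (integrand s) 0 := by
  have hre : 0 < (-s - 1).re := by rw [sub_re, neg_re, one_re]; linarith
  set D : ℂ → ℂ := fun x => exp (π * I * x) - exp (-(π * I * x)) with hD
  have hderiv : HasDerivAt D (2 * (π * I)) 0 := by
    have h := (hasDerivAt_id (0 : ℂ)).const_mul (π * I)
    refine (h.cexp.sub h.neg.cexp).congr_deriv ?_
    simp [two_mul]
  have hfactor : integrand s = fun x => x ^ (-s - 1) * exp (π * I * x ^ 2) / dslope D 0 x := by
    ext x
    rcases eq_or_ne x 0 with rfl | hx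
    · simp [integrand, zero_cpow (fun h => by simp [h] at hre : -s - 1 ≠ 0)]
    · rw [dslope_of_ne _ hx, slope_def_field, cpow_sub _ _ hx, cpow_one, integrand]
      simp only [hD, mul_zero, neg_zero, sub_self, sub_zero]
      field_simp
  rw [hfactor]
  refine ((continuousAt_cpow_const_of_re_pos (by simp) hre).mul (by fun_prop)).div
    (continuousAt_dslope_same.2 hderiv.differentiableAt) ?_
  simp [hderiv.deriv, Real.pi_ne_zero]

theorem continuousAt_integrand (hs : s.re < -1) (hx : x.re - x.im ∈ Ico 0 1) :
    ContinuousAt (integrand s) x := by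
  rcases eq_or_ne x 0 with rfl | hx₀
  · exact continuousAt_integrand_zero hs
  · exact (differentiableAt_integrand s hx hx₀).continuousAt

theorem norm_cpow_neg_le (hs : s.re ≤ 0) (x : ℂ) :
    ‖x ^ (-s)‖ ≤ Real.exp (s.re ^ 2 / 4 + ‖x‖ ^ 2 + π * |s.im|) := by
  have hbase : ‖x‖ ^ (-s.re) ≤ Real.exp (s.re ^ 2 / 4 + ‖x‖ ^ 2) := by
    calc ‖x‖ ^ (-s.re) ≤ Real.exp ‖x‖ ^ (-s.re) :=
          Real.rpow_le_rpow (norm_nonneg _) (by linarith [Real.add_one_le_exp ‖x‖]) (by linarith)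
      _ = Real.exp (‖x‖ * -s.re) := (Real.exp_mul _ _).symm
      _ ≤ _ := Real.exp_le_exp.2 (by nlinarith [sq_nonneg (s.re / 2 + ‖x‖)])
  have harg : -(x.arg * (-s).im) ≤ π * |s.im| := by
    refine (neg_le_abs _).trans ?_
    rw [abs_mul, neg_im, abs_neg]
    gcongr
    exact abs_arg_le_pi x
  refine (norm_cpow_le _ _).trans ?_
  rw [Real.exp_add, div_eq_mul_inv, ← Real.exp_neg, neg_re]
  gcongr

theorem norm_exp_pi_mul_I_mul_sq (x : ℂ) :
    ‖exp (π * I * x ^ 2)‖ = Real.exp (π * ((x.re - x.im) ^ 2 - ‖x‖ ^ 2)) := by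
  rw [norm_exp, ← normSq_eq_norm_sq, normSq_apply, mul_assoc, re_ofReal_mul, I_mul_re, sq x, mul_im]
  ring_nf

theorem norm_integrand_le (hs : s.re ≤ 0) (hx : x.re - x.im ∈ Icc 0 (1 / 2)) (hx₁ : 1 ≤ ‖x‖) :
    ‖integrand s x‖ ≤ Real.exp (s.re ^ 2 / 4 + π * |s.im| + π) * Real.exp (-‖x‖ ^ 2) := by
  have hden : 1 ≤ ‖exp (π * I * x) - exp (-(π * I * x))‖ := by
    have him : 1 / 4 ≤ |x.im| := by
      have := norm_le_abs_re_add_abs_im x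
      have := abs_sub_abs_le_abs_sub x.re x.im
      rw [abs_of_nonneg hx.1] at this
      linarith [hx.2]
    nlinarith [two_pi_mul_abs_im_le_norm x, Real.pi_gt_three]
  have hexp : π * ((x.re - x.im) ^ 2 - ‖x‖ ^ 2) ≤ π - 2 * ‖x‖ ^ 2 := by
    have : (x.re - x.im) ^ 2 ≤ 1 := pow_le_one₀ hx.1 (by linarith [hx.2])
    nlinarith [Real.pi_gt_three, sq_nonneg ‖x‖]
  rw [integrand, norm_div, norm_mul, norm_exp_pi_mul_I_mul_sq]
  calc _ ≤ ‖x ^ (-s)‖ * Real.exp (π * ((x.re - x.im) ^ 2 - ‖x‖ ^ 2)) :=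
        div_le_self (by positivity) hden
    _ ≤ Real.exp (s.re ^ 2 / 4 + ‖x‖ ^ 2 + π * |s.im|) * Real.exp (π - 2 * ‖x‖ ^ 2) := by
        gcongr
        exact norm_cpow_neg_le hs x
    _ = _ := by
        rw [← Real.exp_add, ← Real.exp_add]
        ring_nf

theorem integrand_neg (hx : 0 < x.im) :
    integrand s (-x) = -(exp (π * I * s) * integrand s x) := by
  have hx₀ : x ≠ 0 := fun h => by simp [h] at hx
  have hpow : (-x) ^ (-s) = exp (π * I * s) * x ^ (-s) := by
    rw [cpow_def_of_ne_zero (neg_ne_zero.2 hx₀), cpow_def_of_ne_zero hx₀, ← exp_add, log, log,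
      norm_neg, arg_neg_eq_arg_sub_pi_of_im_pos hx]
    push_cast
    ring_nf
  rw [integrand, integrand, hpow, neg_sq, mul_neg (π * I : ℂ) x, neg_neg,
    ← neg_sub (exp (π * I * x)), div_neg]
  ring

end Integrand

section Ray

variable {s τ w : ℂ}

theorem exp_pi_mul_I_div_four : exp (π * I / 4) = √2 / 2 + √2 / 2 * I := by
  rw [show (π * I / 4 : ℂ) = ((π / 4 : ℝ) : ℂ) * I by push_cast; ring, exp_mul_I,
    ← ofReal_cos, ← ofReal_sin, Real.cos_pi_div_four, Real.sin_pi_div_four]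
  push_cast
  rfl

theorem norm_exp_pi_mul_I_div_four_mul (w : ℂ) : ‖exp (π * I / 4) * w‖ = ‖w‖ := by
  rw [norm_mul, show (π * I / 4 : ℂ) = ((π / 4 : ℝ) : ℂ) * I by push_cast; ring,
    norm_exp_ofReal_mul_I, one_mul]

theorem re_sub_im_exp_pi_mul_I_div_four_mul (w : ℂ) :
    (exp (π * I / 4) * w).re - (exp (π * I / 4) * w).im = -√2 * w.im := by
  rw [exp_pi_mul_I_div_four]
  simp only [mul_re, mul_im, add_re, add_im, div_ofNat_re, div_ofNat_im, ofReal_re, ofReal_im, I_re,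
    I_im, mul_zero, zero_div, mul_one, sub_self, add_zero, zero_add]
  ring

theorem re_sub_im_mem_Icc (hw : w.im ∈ Icc (-(√2 / 4)) 0) :
    (exp (π * I / 4) * w).re - (exp (π * I / 4) * w).im ∈ Icc 0 (1 / 2) := by
  have h₂ : √2 * √2 = 2 := Real.mul_self_sqrt zero_le_two
  rw [re_sub_im_exp_pi_mul_I_div_four_mul]
  constructor <;> nlinarith [hw.1, hw.2, Real.sqrt_nonneg 2]

theorem eventually_norm_integrand_le (hs : s.re ≤ 0) :
    ∀ᶠ a : ℝ in cocompact ℝ, ∀ y ∈ Icc (-(√2 / 4)) 0,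
      ‖integrand s (exp (π * I / 4) * (a + y * I))‖ ≤
        Real.exp (s.re ^ 2 / 4 + π * |s.im| + π) * Real.exp (-1 * a ^ 2) := by
  filter_upwards [(tendsto_norm_cocompact_atTop (E := ℝ)).eventually_ge_atTop 1] with a ha y hy
  have hre : |a| ≤ ‖a + y * I‖ := by simpa using abs_re_le_norm (a + y * I)
  have hle := norm_integrand_le (s := s) (x := exp (π * I / 4) * (a + y * I)) hs
    (re_sub_im_mem_Icc (by simpa using hy))
    (by rw [norm_exp_pi_mul_I_div_four_mul]; exact ha.trans hre)
  refine hle.trans ?_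
  rw [norm_exp_pi_mul_I_div_four_mul, neg_one_mul, ← sq_abs a]
  gcongr

theorem continuousAt_integrand_comp (hs : s.re < -1) (hw : w.im ∈ Icc (-(√2 / 4)) 0) :
    ContinuousAt (fun w => integrand s (exp (π * I / 4) * w)) w :=
  ContinuousAt.comp (g := integrand s)
    (continuousAt_integrand hs (Icc_subset_Ico_right (by norm_num) (re_sub_im_mem_Icc hw)))
    (by fun_prop)

theorem integrable_integrand_line (hs : s.re < -1) :
    Integrable fun a : ℝ => integrand s (exp (π * I / 4) * a) := by
  have h₀ : (0 : ℝ) ∈ Icc (-(√2 / 4)) 0 := right_mem_Icc.2 (neg_nonpos.2 (by positivity))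
  refine integrable_of_eventually_norm_le_cocompact
    (continuous_iff_continuousAt.2 fun a =>
      (continuousAt_integrand_comp hs (by rwa [ofReal_im])).comp continuous_ofReal.continuousAt)
    ((integrable_exp_neg_mul_sq one_pos).const_mul (Real.exp (s.re ^ 2 / 4 + π * |s.im| + π)))
    ((eventually_norm_integrand_le (by linarith)).mono fun a ha => ?_)
  simpa using ha 0 h₀

theorem exp_neg_three_pi_mul_I_div_four : exp (-(3 * π * I / 4)) = -exp (π * I / 4) := by
  rw [show -(3 * π * I / 4 : ℂ) = π * I / 4 - π * I by ring, exp_sub, exp_pi_mul_I, div_neg,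
    div_one]

theorem path_eq (u : ℝ) :
    path u = exp (π * I / 4) * ((√2 / 4 - u : ℝ) + (-(√2 / 4) : ℝ) * I) := by
  have h₂ : (√2 : ℂ) ^ 2 = 2 := by rw [← ofReal_pow, Real.sq_sqrt zero_le_two, ofReal_ofNat]
  rw [path, exp_neg_three_pi_mul_I_div_four, exp_pi_mul_I_div_four]
  push_cast
  linear_combination (I ^ 2 / 8 - 1 / 8) * h₂ + I_sq / 4

theorem auxR_eq_integral_line (hs : s.re < -1) :
    auxR s = -(exp (π * I / 4) * ∫ a : ℝ, integrand s (exp (π * I / 4) * a)) := by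
  have hpath : auxR s = -(exp (π * I / 4) *
      ∫ a : ℝ, integrand s (exp (π * I / 4) * (a + (-(√2 / 4) : ℝ) * I))) := by
    rw [← integral_sub_left_eq_self _ _ (√2 / 4), ← integral_const_mul, ← integral_neg, auxR]
    congr with u
    rw [exp_neg_three_pi_mul_I_div_four, path_eq]
    ring
  have hle : -(√2 / 4) ≤ 0 := neg_nonpos.2 (by positivity)
  have hIcc : uIcc (-(√2 / 4)) 0 = Icc (-(√2 / 4)) 0 := uIcc_of_le hle
  rw [hpath, integral_horizontal_line_eq (H := fun w => integrand s (exp (π * I / 4) * w)) (y₂ := 0)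
    (fun w hw => (continuousAt_integrand_comp hs (hIcc ▸ hw)).continuousWithinAt) ?_
    ((integrable_exp_neg_mul_sq one_pos).const_mul _) ?_
    (by simpa only [hIcc] using eventually_norm_integrand_le (s := s) (by linarith))]
  · simp
  · intro w hw
    rw [min_eq_left hle, max_eq_right hle] at hw
    have hw₀ : w ≠ 0 := fun h => by simp [h] at hw
    exact DifferentiableAt.differentiableWithinAt <| DifferentiableAt.comp (g := integrand s) w
      (differentiableAt_integrand s (Icc_subset_Ico_right (by norm_num)
        (re_sub_im_mem_Icc (Ioo_subset_Icc_self hw))) (by simp [hw₀])) (by fun_prop)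
  · simpa using (tendsto_rpow_abs_mul_exp_neg_mul_sq_cocompact one_pos 0).const_mul
      (Real.exp (s.re ^ 2 / 4 + π * |s.im| + π))

/-- The integrand of `𝓡(1 - τ)` times `dx/dw`, in the variable `w = log x`. -/
noncomputable def rayIntegrand (τ w : ℂ) : ℂ :=
  exp (τ * w) * exp (π * I * exp w ^ 2) / (exp (π * I * exp w) - exp (-(π * I * exp w)))

theorem exp_mul_integrand_exp (s : ℂ) (hw : w.im ∈ Ioc (-π) π) :
    exp w * integrand s (exp w) = rayIntegrand (1 - s) w := by
  rw [integrand, rayIntegrand, cpow_def_of_ne_zero (exp_ne_zero w), log_exp hw.1 hw.2,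
    show (1 - s) * w = w + w * -s by ring, exp_add]
  ring

theorem integral_Ioi_integrand (s : ℂ) :
    ∫ a in Ioi (0 : ℝ), exp (π * I / 4) * integrand s (exp (π * I / 4) * a) =
      ∫ a : ℝ, rayIntegrand (1 - s) (a + (π / 4 : ℝ) * I) := by
  rw [integral_Ioi_eq_integral_exp_smul]
  congr with a
  have hexp : exp (a + (π / 4 : ℝ) * I) = exp (π * I / 4) * (Real.exp a : ℝ) := by
    rw [exp_add, ← ofReal_exp, mul_comm]
    push_cast
    ring_nf
  rw [← exp_mul_integrand_exp s (by constructor <;> simp <;> linarith [Real.pi_pos]), hexp,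
    real_smul]
  ring

theorem integral_Iic_integrand (s : ℂ) :
    ∫ a in Iic (0 : ℝ), exp (π * I / 4) * integrand s (exp (π * I / 4) * a) =
      -(exp (π * I * s) *
        ∫ a in Ioi (0 : ℝ), exp (π * I / 4) * integrand s (exp (π * I / 4) * a)) := by
  rw [← neg_zero (G := ℝ), ← integral_comp_neg_Ioi, neg_zero, ← integral_const_mul, ← integral_neg]
  refine setIntegral_congr_fun measurableSet_Ioi fun a (ha : 0 < a) => ?_
  have him : 0 < (exp (π * I / 4) * a).im := by
    rw [exp_pi_mul_I_div_four]
    simpa using ha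
  simp only [ofReal_neg, mul_neg, integrand_neg him]
  ring

theorem auxR_eq_integral_ray (hs : s.re < -1) :
    auxR s = (exp (π * I * s) - 1) * ∫ a : ℝ, rayIntegrand (1 - s) (a + (π / 4 : ℝ) * I) := by
  have hint := (integrable_integrand_line hs).const_mul (exp (π * I / 4))
  rw [auxR_eq_integral_line hs, ← integral_const_mul,
    ← intervalIntegral.integral_Iic_add_Ioi hint.integrableOn hint.integrableOn (b := 0),
    integral_Iic_integrand, integral_Ioi_integrand]
  ring

theorem norm_rayIntegrand_le (τ : ℂ) (hw : w.im ∈ Ioo 0 (π / 2)) :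
    ‖rayIntegrand τ w‖ ≤ Real.exp (|τ.im| * π) / (2 * π * Real.sin w.im) *
      Real.exp ((τ.re - 1) * w.re - π * Real.sin (2 * w.im) * Real.exp (2 * w.re)) := by
  have hsin : 0 < Real.sin w.im := Real.sin_pos_of_pos_of_lt_pi hw.1 (by linarith [hw.2, hw.1])
  have hden := two_pi_mul_abs_im_le_norm (exp w)
  rw [exp_im, abs_of_pos (by positivity)] at hden
  have hpow : ‖exp (τ * w)‖ ≤ Real.exp (|τ.im| * π + τ.re * w.re) := by
    have : -(τ.im * w.im) ≤ |τ.im| * π := by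
      refine (neg_le_abs _).trans ?_
      rw [abs_mul, abs_of_pos hw.1]
      gcongr
      linarith [hw.1, hw.2]
    rw [norm_exp, mul_re, Real.exp_le_exp]
    linarith
  have hgauss : ‖exp (π * I * exp w ^ 2)‖ =
      Real.exp (-(π * Real.sin (2 * w.im) * Real.exp (2 * w.re))) := by
    rw [norm_exp, ← exp_nat_mul, mul_assoc, re_ofReal_mul, I_mul_re, exp_im]
    simp only [Nat.cast_ofNat, mul_re, mul_im, re_ofNat, im_ofNat, zero_mul, sub_zero, add_zero,
      mul_neg, Real.exp_eq_exp]
    ring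
  rw [rayIntegrand, norm_div, norm_mul, hgauss]
  calc _ ≤ Real.exp (|τ.im| * π + τ.re * w.re) *
        Real.exp (-(π * Real.sin (2 * w.im) * Real.exp (2 * w.re))) /
          (2 * π * (Real.exp w.re * Real.sin w.im)) := by gcongr
    _ = _ := by
      rw [sub_eq_add_neg ((τ.re - 1) * w.re), sub_one_mul, Real.exp_add, Real.exp_add,
        Real.exp_sub]
      field_simp

theorem differentiableAt_rayIntegrand (τ : ℂ) (hw : w.im ∈ Ioo 0 π) :
    DifferentiableAt ℂ (rayIntegrand τ) w := by
  have hden := two_pi_mul_abs_im_le_norm (exp w)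
  have hsin := Real.sin_pos_of_mem_Ioo hw
  rw [exp_im, abs_of_pos (by positivity)] at hden
  unfold rayIntegrand
  exact .div (by fun_prop) (by fun_prop) (norm_pos_iff.1 (lt_of_lt_of_le (by positivity) hden))

end Ray

section SaddlePointOfR

variable {s τ w : ℂ}

/-- The logarithm of the saddle point `η`, in terms of `τ = 1 - s`. -/
noncomputable def logEta (τ : ℂ) : ℂ := π * I / 4 + log (τ / (2 * π)) / 2

theorem div_two_pi_eq_real_mul (τ : ℂ) : τ / (2 * π) = ((2 * π)⁻¹ : ℝ) * τ := by
  push_cast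
  rw [div_eq_inv_mul]

theorem logEta_im (τ : ℂ) : (logEta τ).im = π / 4 + τ.arg / 2 := by
  rw [logEta, add_im, div_ofNat_im, div_ofNat_im, mul_I_im, ofReal_re, log_im,
    div_two_pi_eq_real_mul, arg_real_mul _ (by positivity)]

theorem exp_logEta (hs : s ≠ 1) : exp (logEta (1 - s)) = eta s := by
  have h : (1 - s) / (2 * π) ≠ 0 := by simp [sub_ne_zero.2 hs.symm, Real.pi_ne_zero]
  rw [logEta, exp_add, eta, cpow_def_of_ne_zero h]
  ring_nf

theorem exp_two_mul_logEta (hτ : τ ≠ 0) : exp (2 * logEta τ) = I * τ / (2 * π) := by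
  have h : τ / (2 * π) ≠ 0 := by simp [hτ, Real.pi_ne_zero]
  rw [logEta, show 2 * (π * I / 4 + log (τ / (2 * π)) / 2) = π / 2 * I + log (τ / (2 * π)) by ring,
    exp_add, exp_pi_div_two_mul_I, exp_log h, mul_div_assoc]

theorem integral_rayIntegrand_rotate (hτ : 1 < τ.re) :
    ∫ a : ℝ, rayIntegrand τ (a + (π / 4 : ℝ) * I) = ∫ a : ℝ, rayIntegrand τ (a + logEta τ) := by
  have harg := abs_arg_lt_pi_div_two_iff.2 (Or.inl (zero_lt_one.trans hτ))
  have harg₀ := abs_nonneg τ.arg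
  have him : ∀ w : ℂ, w.im ∈ uIcc (π / 4) (logEta τ).im → |w.im - π / 4| ≤ |τ.arg| / 2 := by
    intro w hw
    have := abs_sub_left_of_mem_uIcc hw
    rwa [logEta_im, add_sub_cancel_left, abs_div, abs_two] at this
  have hsin₀ : 0 < Real.sin (π / 4 - |τ.arg| / 2) :=
    Real.sin_pos_of_pos_of_lt_pi (by linarith) (by linarith)
  have hcos₀ : 0 < Real.cos τ.arg := Real.cos_pos_of_mem_Ioo (abs_lt.1 harg)
  refine integral_add_eq_integral_add_of_norm_le (p := τ.re - 1) (κ := π * Real.cos τ.arg)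
    (C := Real.exp (|τ.im| * π) / (2 * π * Real.sin (π / 4 - |τ.arg| / 2)))
    (by linarith) (by positivity) (by positivity) (fun w hw => ?_) (fun w hw => ?_)
  · have := abs_le.1 (him w hw)
    exact differentiableAt_rayIntegrand τ ⟨by linarith, by linarith⟩
  · have hle := abs_le.1 (him w hw)
    have hsin : Real.sin (π / 4 - |τ.arg| / 2) ≤ Real.sin w.im :=
      Real.sin_le_sin_of_le_of_le_pi_div_two (by linarith) (by linarith) (by linarith)
    have hcos : Real.cos τ.arg ≤ Real.sin (2 * w.im) := by
      rw [← Real.cos_sub_pi_div_two, ← Real.cos_abs τ.arg, ← Real.cos_abs (2 * w.im - π / 2)]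
      exact Real.cos_le_cos_of_nonneg_of_le_pi (abs_nonneg _) (by linarith)
        (abs_le.2 ⟨by linarith, by linarith⟩)
    refine (norm_rayIntegrand_le τ ⟨by linarith, by linarith⟩).trans ?_
    gcongr

/-- The amplitude of the saddle point integral for `𝓡`, where `b = πiη`. -/
noncomputable def amplitude (b : ℂ) (v : ℝ) : ℂ := exp (b * (v - 1 : ℝ)) / (1 - exp (2 * b * v))

theorem amplitude_eq (b : ℂ) (v : ℝ) :
    amplitude b v = -(exp (-b) / (exp (b * v) - exp (-(b * v)))) := by
  have hnum : exp (b * (v - 1 : ℝ)) = exp (b * v) * exp (-b) := by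
    rw [← exp_add]
    push_cast
    ring_nf
  have hden : 1 - exp (2 * b * v) = -(exp (b * v) * (exp (b * v) - exp (-(b * v)))) := by
    rw [mul_sub, ← exp_add, ← exp_add, add_neg_cancel, exp_zero]
    ring_nf
  rw [amplitude, hnum, hden, div_neg, mul_div_mul_left _ _ (exp_ne_zero _)]

theorem integral_rayIntegrand_add_logEta (hτ : τ ≠ 0) :
    ∫ a : ℝ, rayIntegrand τ (a + logEta τ) =
      -(exp (τ * logEta τ - τ / 2 + π * I * exp (logEta τ)) *
        saddleIntegral τ (amplitude (π * I * exp (logEta τ)))) := by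
  rw [saddleIntegral_eq_integral_exp, ← integral_const_mul, ← integral_neg]
  congr with a
  have hsq : exp (a + logEta τ) ^ 2 = I * τ / (2 * π) * exp (2 * a) := by
    rw [← exp_nat_mul, ← exp_two_mul_logEta hτ, ← exp_add]
    push_cast
    ring_nf
  have hb : π * I * exp (a + logEta τ) = π * I * exp (logEta τ) * Real.exp a := by
    rw [exp_add, ofReal_exp]
    ring
  have hexp : exp (τ * (a + logEta τ)) * exp (π * I * (I * τ / (2 * π) * exp (2 * a))) =
      exp (τ * logEta τ - τ / 2) * exp (τ * a - τ * exp (2 * a) / 2 + τ / 2) := by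
    rw [← exp_add, ← exp_add]
    have : (π : ℂ) ≠ 0 := ofReal_ne_zero.2 Real.pi_ne_zero
    generalize exp (2 * a) = E
    congr 1
    field_simp
    linear_combination E * I_sq
  rw [rayIntegrand, hsq, hb, hexp, amplitude_eq, exp_add _ (π * I * exp (logEta τ)),
    exp_neg (π * I * exp (logEta τ))]
  field_simp [exp_ne_zero (π * I * exp (logEta τ))]

theorem one_sub_exp_pi_mul_I_mul (s : ℂ) :
    1 - exp (π * I * s) = 2 * sin (π * s / 2) * exp (-(π * I * (1 - s) / 2)) := by
  have hexp : exp (-(π * I * (1 - s) / 2)) = -I * exp (π * s / 2 * I) := by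
    rw [← exp_neg_pi_div_two_mul_I, ← exp_add]
    ring_nf
  have hsq : exp (π * I * s) = exp (π * s / 2 * I) ^ 2 := by
    rw [← exp_nat_mul]
    push_cast
    ring_nf
  rw [hexp, hsq, sin, neg_mul (π * s / 2) I, exp_neg]
  have hE := exp_ne_zero (π * s / 2 * I)
  generalize exp (π * s / 2 * I) = E at hE ⊢
  field_simp
  linear_combination (1 - E ^ 2) * I_sq

theorem auxR_eq_saddleIntegral (hs : s.re < -1) :
    auxR s = 2 * sin (π * s / 2) * exp ((1 - s) * logEta (1 - s) - π * I * (1 - s) / 2 -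
      (1 - s) / 2 + π * I * eta s) * saddleIntegral (1 - s) (amplitude (π * I * eta s)) := by
  have hs₁ : s ≠ 1 := fun h => by norm_num [h] at hs
  rw [auxR_eq_integral_ray hs, integral_rayIntegrand_rotate (by rw [sub_re, one_re]; linarith),
    integral_rayIntegrand_add_logEta (sub_ne_zero.2 hs₁.symm), exp_logEta hs₁,
    show ∀ A B C D : ℂ, A - B - C + D = A - C + D + -B by intros; ring, exp_add _ (-_)]
  linear_combination (exp ((1 - s) * logEta (1 - s) - (1 - s) / 2 + π * I * eta s) *
    saddleIntegral (1 - s) (amplitude (π * I * eta s))) * one_sub_exp_pi_mul_I_mul s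

theorem chi_eq_saddleIntegral (hs : s.re < 1) :
    chi s = 4 * sin (π * s / 2) *
      exp (2 * (1 - s) * logEta (1 - s) - π * I * (1 - s) / 2 - (1 - s)) *
        saddleIntegral (2 * (1 - s)) 1 := by
  have hre : 0 < (1 - s).re := by rw [sub_re, one_re]; linarith
  have hτ : 1 - s ≠ 0 := fun h => by simp [h] at hre
  have hlog : 2 * (1 - s) * logEta (1 - s) =
      π * I * (1 - s) / 2 + (1 - s) * log (1 - s) + Real.log (2 * π) * (s - 1) := by
    rw [logEta, div_two_pi_eq_real_mul, log_ofReal_mul (by positivity) hτ, Real.log_inv]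
    push_cast
    ring
  have hpow : (2 * π : ℂ) ^ (s - 1) = exp (Real.log (2 * π) * (s - 1)) := by
    rw [cpow_def_of_ne_zero (by simp [Real.pi_ne_zero]), ofReal_log (by positivity)]
    push_cast
    rfl
  rw [chi, hpow, Gamma_eq_saddleIntegral hre, hlog,
    show ∀ A B C D : ℂ, A + B + C - A - D = C + (B - D) by intros; ring, exp_add]
  ring

theorem eta_cpow_mul_exp (hs : s.re < 1) :
    eta s ^ (s - 1) * exp (π * I * (eta s - eta s ^ 2)) =
      exp (-((1 - s) * logEta (1 - s)) + π * I * eta s + (1 - s) / 2) := by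
  have hs₁ : s ≠ 1 := fun h => by simp [h] at hs
  have harg := abs_lt.1 (abs_arg_lt_pi_div_two_iff.2 (Or.inl (show 0 < (1 - s).re by
    rw [sub_re, one_re]; linarith)))
  have hlog : log (eta s) = logEta (1 - s) := by
    rw [← exp_logEta hs₁, log_exp] <;> rw [logEta_im] <;> linarith [Real.pi_pos]
  have hsq : π * I * eta s ^ 2 = (s - 1) / 2 := by
    have : (π : ℂ) ≠ 0 := ofReal_ne_zero.2 Real.pi_ne_zero
    rw [eta_sq]
    field_simp
  rw [cpow_def_of_ne_zero (by rw [← exp_logEta hs₁]; exact exp_ne_zero _), hlog, ← exp_add,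
    mul_sub (π * I), hsq]
  ring_nf

theorem auxR_mul_saddleIntegral (hs : s.re < -1) :
    auxR s * (2 * saddleIntegral (2 * (1 - s)) 1) =
      chi s * (eta s ^ (s - 1) * exp (π * I * (eta s - eta s ^ 2))) *
        saddleIntegral (1 - s) (amplitude (π * I * eta s)) := by
  have hexp : exp ((1 - s) * logEta (1 - s) - π * I * (1 - s) / 2 - (1 - s) / 2 + π * I * eta s) =
      exp (2 * (1 - s) * logEta (1 - s) - π * I * (1 - s) / 2 - (1 - s)) *
        exp (-((1 - s) * logEta (1 - s)) + π * I * eta s + (1 - s) / 2) := by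
    rw [← exp_add]
    ring_nf
  rw [auxR_eq_saddleIntegral hs, chi_eq_saddleIntegral (by linarith),
    eta_cpow_mul_exp (by linarith), hexp]
  ring

end SaddlePointOfR

section Amplitudes

variable {B v : ℝ} {τ b z : ℂ}

theorem norm_exp_div_one_sub_exp_le (hz : z.re < 0) : ‖exp z / (1 - exp z)‖ ≤ 1 / -z.re := by
  have hlt : Real.exp z.re < 1 := Real.exp_lt_one_iff.2 hz
  have hden : 1 - Real.exp z.re ≤ ‖1 - exp z‖ := by
    simpa only [norm_one, norm_exp] using norm_sub_norm_le 1 (exp z)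
  calc ‖exp z / (1 - exp z)‖ = Real.exp z.re / ‖1 - exp z‖ := by rw [norm_div, norm_exp]
    _ ≤ Real.exp z.re / (1 - Real.exp z.re) := by gcongr
    _ ≤ 1 / -z.re := by
        rw [div_le_div_iff₀ (by linarith) (by linarith)]
        have hmul : Real.exp z.re * (-z.re + 1) ≤ Real.exp z.re * Real.exp (-z.re) := by
          gcongr
          exact Real.add_one_le_exp _
        rw [← Real.exp_add, add_neg_cancel, Real.exp_zero] at hmul
        linarith

theorem one_sub_exp_ne_zero (hz : z.re < 0) : 1 - exp z ≠ 0 := by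
  intro h
  have hnorm := congrArg norm (sub_eq_zero.1 h)
  rw [norm_one, norm_exp] at hnorm
  exact (Real.exp_lt_one_iff.2 hz).ne hnorm.symm

theorem two_mul_mul_re_neg (hb : b.re < 0) (hv : 0 < v) : (2 * b * v).re < 0 := by
  rw [re_mul_ofReal, mul_re, re_ofNat, im_ofNat, zero_mul, sub_zero]
  exact mul_neg_of_neg_of_pos (by linarith) hv

theorem amplitude_sub_exp (hb : b.re < 0) (hv : 0 < v) :
    amplitude b v - exp (b * (v - 1 : ℝ)) =
      exp (2 * b * v) / (1 - exp (2 * b * v)) * exp (b * (v - 1 : ℝ)) := by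
  have hne := one_sub_exp_ne_zero (two_mul_mul_re_neg hb hv)
  rw [amplitude]
  generalize exp (2 * b * v) = E at hne ⊢
  field_simp
  ring

theorem norm_amplitude_sub_exp_le (hb : b.re < 0) (hv : 0 < v) :
    ‖amplitude b v - exp (b * (v - 1 : ℝ))‖ ≤
      1 / (2 * -b.re * v) * ‖exp (b * (v - 1 : ℝ))‖ := by
  rw [amplitude_sub_exp hb hv, norm_mul]
  gcongr
  refine (norm_exp_div_one_sub_exp_le (two_mul_mul_re_neg hb hv)).trans_eq ?_
  rw [re_mul_ofReal, mul_re, re_ofNat, im_ofNat, zero_mul, sub_zero]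
  ring

theorem continuousOn_amplitude (hb : b.re < 0) : ContinuousOn (amplitude b) (Ioi 0) :=
  ContinuousOn.div (by fun_prop) (by fun_prop)
    fun _ hv => one_sub_exp_ne_zero (two_mul_mul_re_neg hb hv)

theorem isAmplitude_amplitude (hB : 1 ≤ B) (hτ : τ ≠ 0) (hb : b.re ≤ -1)
    (hbτ : ‖b‖ ≤ B * √‖τ‖) (hτb : √‖τ‖ ≤ B * -b.re) : IsAmplitude B τ b (amplitude b) where
  continuousOn := continuousOn_amplitude (by linarith)
  norm_le := hbτ
  near v hv := by
    have hτ₀ : 0 < √‖τ‖ := Real.sqrt_pos.2 (norm_pos_iff.2 hτ)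
    have hle : 1 / (2 * -b.re * v) ≤ B / √‖τ‖ := by
      rw [div_le_div_iff₀ (by nlinarith) hτ₀, one_mul]
      calc √‖τ‖ ≤ B * -b.re := hτb
        _ ≤ B * (2 * -b.re * v) := by gcongr; nlinarith
    exact (norm_amplitude_sub_exp_le (by linarith) (by linarith)).trans <|
      mul_le_mul hle (norm_exp_mul_sub_one_le hbτ v) (norm_nonneg _) (by positivity)
  origin v hv₀ hv := by
    have hle : 1 / (2 * -b.re * v) + 1 ≤ B / v := by
      calc 1 / (2 * -b.re * v) + 1 ≤ 1 / (2 * 1 * v) + 1 / (2 * v) := by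
            gcongr
            · linarith
            · rw [le_div_iff₀ (by linarith)]
              linarith
        _ = 1 / v := by field_simp; norm_num
        _ ≤ B / v := by gcongr
    calc ‖amplitude b v‖
        ≤ ‖amplitude b v - exp (b * (v - 1 : ℝ))‖ + ‖exp (b * (v - 1 : ℝ))‖ :=
          norm_le_norm_sub_add _ _
      _ ≤ (1 / (2 * -b.re * v) + 1) * ‖exp (b * (v - 1 : ℝ))‖ := by
          rw [add_mul, one_mul]
          gcongr
          exact norm_amplitude_sub_exp_le (by linarith) hv₀
      _ ≤ B / v * Real.exp (B * saddleDist τ v) :=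
          mul_le_mul hle (norm_exp_mul_sub_one_le hbτ v) (norm_nonneg _) (by positivity)

theorem isAmplitude_one (hB : 1 ≤ B) (τ : ℂ) : IsAmplitude B τ 0 1 where
  continuousOn := continuousOn_const
  norm_le := by rw [norm_zero]; positivity
  near v _ := by
    rw [zero_mul, exp_zero, Pi.one_apply, sub_self, norm_zero]
    positivity
  origin v hv₀ hv := by
    have hv' : 1 ≤ B / v := (one_le_div hv₀).2 (by linarith)
    have hexp : 1 ≤ Real.exp (B * saddleDist τ v) :=
      Real.one_le_exp (mul_nonneg (by linarith) (saddleDist_nonneg τ v))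
    rw [Pi.one_apply, norm_one]
    exact one_le_mul_of_one_le_of_one_le hv' hexp

end Amplitudes

section Sector

variable {α δ : ℝ} {τ s : ℂ}

/-- The closed sector of half-opening `π / 2 - δ` about the positive real axis, the range of
`τ = 1 - s` in the asymptotic expansion. -/
def sector (δ : ℝ) : Set ℂ := {τ | |τ.arg| ≤ π / 2 - δ}

theorem one_sub_mem_sector_of_mem_G (hα₀ : 0 < α) (hα : α < π / 4) (hs : s ∈ G α) :
    1 - s ∈ sector (2 * α) := by
  have hcos : 0 < Real.cos (2 * α) := Real.cos_pos_of_mem_Ioo ⟨by linarith, by linarith⟩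
  have htan : |(1 - s).im| * Real.tan (2 * α) ≤ (1 - s).re := by
    rwa [sub_im, one_im, zero_sub, abs_neg, sub_re, one_re]
  generalize 1 - s = τ at htan
  rcases eq_or_ne τ 0 with rfl | hτ
  · simp only [sector, mem_ofPred_eq, arg_zero, abs_zero]
    linarith
  have him : |τ.im| = ‖τ‖ * Real.sin |τ.arg| := by
    rw [← Real.abs_sin_eq_sin_abs_of_abs_le_pi (abs_arg_le_pi τ), ← norm_mul_sin_arg, abs_mul,
      abs_norm]
  rw [him, ← norm_mul_cos_arg, ← Real.cos_abs, Real.tan_eq_sin_div_cos, mul_div_assoc',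
    div_le_iff₀ hcos] at htan
  have hcos_add : 0 ≤ ‖τ‖ * Real.cos (|τ.arg| + 2 * α) := by
    rw [Real.cos_add]
    linarith
  by_contra hmem
  rw [sector, mem_ofPred_eq, not_le] at hmem
  have hneg : Real.cos (|τ.arg| + 2 * α) < 0 :=
    Real.cos_neg_of_pi_div_two_lt_of_lt (by linarith) (by linarith [abs_arg_le_pi τ])
  exact hcos_add.not_gt (mul_neg_of_pos_of_neg (norm_pos_iff.2 hτ) hneg)

theorem sin_mul_norm_le_re (hδ : 0 ≤ δ) (hτ : τ ∈ sector δ) : Real.sin δ * ‖τ‖ ≤ τ.re := by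
  have hcos : Real.cos (π / 2 - δ) ≤ Real.cos |τ.arg| :=
    Real.cos_le_cos_of_nonneg_of_le_pi (abs_nonneg _) (by linarith [Real.pi_pos]) hτ
  rw [Real.cos_pi_div_two_sub, Real.cos_abs] at hcos
  rw [← norm_mul_cos_arg, mul_comm]
  gcongr

theorem sin_half_le_sin_logEta_im (hδ : 0 ≤ δ) (hτ : τ ∈ sector δ) :
    Real.sin (δ / 2) ≤ Real.sin (logEta τ).im := by
  have harg : -(π / 2 - δ) ≤ τ.arg ∧ τ.arg ≤ π / 2 - δ := abs_le.1 hτ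
  have hcos : Real.cos (π / 2 - δ / 2) ≤ Real.cos |(logEta τ).im - π / 2| := by
    refine Real.cos_le_cos_of_nonneg_of_le_pi (abs_nonneg _) (by linarith [Real.pi_pos]) ?_
    rw [logEta_im]
    exact abs_le.2 ⟨by linarith, by linarith⟩
  rwa [Real.cos_abs, Real.cos_sub_pi_div_two, Real.cos_pi_div_two_sub] at hcos

theorem tendsto_re_sector (hδ₀ : 0 < δ) (hδ : δ < π) :
    Tendsto re (Bornology.cobounded ℂ ⊓ 𝓟 (sector δ)) atTop := by
  refine tendsto_atTop_mono' _ ?_ ((tendsto_norm_cobounded_atTop.const_mul_atTop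
    (Real.sin_pos_of_pos_of_lt_pi hδ₀ hδ)).mono_left inf_le_left)
  filter_upwards [mem_inf_of_right (mem_principal_self _)] with τ hτ
  exact sin_mul_norm_le_re hδ₀.le hτ

theorem tendsto_one_sub_sector (hα₀ : 0 < α) (hα : α < π / 4) :
    Tendsto (fun s => 1 - s) (Bornology.cobounded ℂ ⊓ 𝓟 (G α))
      (Bornology.cobounded ℂ ⊓ 𝓟 (sector (2 * α))) :=
  (tendsto_const_sub_cobounded 1).inf <|
    tendsto_principal_principal.2 fun _ => one_sub_mem_sector_of_mem_G hα₀ hα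

end Sector

section Asymptotics

variable {ι : Type*} {l : Filter ι}

theorem isBigO_saddleIntegral_sub {B c : ℝ} {τ b : ι → ℂ} {g : ι → ℝ → ℂ} (hc : 0 < c)
    (hτ : Tendsto (fun i => (τ i).re) l atTop) (hcτ : ∀ᶠ i in l, c * ‖τ i‖ ≤ (τ i).re)
    (hg : ∀ᶠ i in l, IsAmplitude B (τ i) (b i) (g i)) :
    (fun i => saddleIntegral (τ i) (g i) - (π / τ i) ^ (1 / 2 : ℂ) * exp (b i ^ 2 / (4 * τ i)))
      =O[l] fun i => ‖τ i‖⁻¹ := by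
  refine IsBigO.of_bound (128 * (1 + B) * Real.exp ((B + 1) ^ 2 / c) * √(4 * π / c)) ?_
  filter_upwards [hg, hcτ, hτ.eventually_ge_atTop 2] with i hgi hci hτi
  rw [norm_inv, norm_norm]
  exact hgi.norm_saddleIntegral_sub_le hc hτi hci

theorem isBigO_div_sub_one {𝕜 : Type*} [NormedField 𝕜] {f g u : ι → 𝕜} {r : ι → ℝ}
    (hgu : g ~[l] u) (hu : ∀ᶠ i in l, u i ≠ 0) (hfg : (f - g) =O[l] fun i => ‖u i‖ * r i) :
    (fun i => f i / g i - 1) =O[l] r := by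
  have hinv : g⁻¹ =O[l] fun i => ‖u⁻¹ i‖ := hgu.inv.isBigO.norm_right
  have hg : ∀ᶠ i in l, g i ≠ 0 := by
    filter_upwards [hgu.isBigO_symm.eq_zero_imp, hu] with i hi hui hgi using hui (hi hgi)
  refine (hfg.mul hinv).congr' ?_ ?_
  · filter_upwards [hg] with i hi
    rw [Pi.sub_apply, Pi.inv_apply, sub_mul, mul_inv_cancel₀ hi, div_eq_mul_inv]
  · filter_upwards [hu] with i hi
    rw [Pi.inv_apply, norm_inv, mul_comm (‖u i‖), mul_inv_cancel_right₀ (norm_ne_zero_iff.2 hi)]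

variable {δ : ℝ} {τ s : ℂ}

theorem norm_exp_logEta (hτ : τ ≠ 0) : ‖exp (logEta τ)‖ = √(‖τ‖ / (2 * π)) := by
  refine (Real.sqrt_eq_iff_mul_self_eq (by positivity) (norm_nonneg _)).2 ?_ |>.symm
  rw [← norm_mul, ← exp_add, ← two_mul, exp_two_mul_logEta hτ, norm_div, norm_mul, norm_mul, norm_I,
    one_mul, norm_ofNat, norm_real, Real.norm_of_nonneg Real.pi_nonneg]

theorem pi_mul_norm_exp_logEta (hτ : τ ≠ 0) : π * ‖exp (logEta τ)‖ = √(π / 2 * ‖τ‖) := by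
  rw [norm_exp_logEta hτ, ← Real.sqrt_sq Real.pi_nonneg, ← Real.sqrt_mul (sq_nonneg π),
    Real.sqrt_sq Real.pi_nonneg]
  field_simp

theorem re_pi_mul_I_mul_exp_logEta (τ : ℂ) :
    (π * I * exp (logEta τ)).re = -(π * ‖exp (logEta τ)‖ * Real.sin (logEta τ).im) := by
  rw [mul_assoc, re_ofReal_mul, I_mul_re, exp_im, norm_exp]
  ring

theorem norm_sqrt_pi_div (τ : ℂ) : ‖(π / τ) ^ (1 / 2 : ℂ)‖ = √(π / ‖τ‖) := by
  rw [show (1 / 2 : ℂ) = (1 / 2 : ℝ) by norm_num, norm_cpow_real, norm_div, norm_real,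
    Real.norm_of_nonneg Real.pi_nonneg, Real.sqrt_eq_rpow]

theorem norm_sqrt_pi_div_mul_norm_exp_logEta_inv (hτ : τ ≠ 0) :
    ‖(π / τ) ^ (1 / 2 : ℂ)‖ * ‖exp (logEta τ)‖⁻¹ = √2 * π * ‖τ‖⁻¹ := by
  have : 0 < ‖τ‖ := norm_pos_iff.2 hτ
  rw [norm_sqrt_pi_div, norm_exp_logEta hτ, ← Real.sqrt_inv, ← Real.sqrt_mul (by positivity),
    show π / ‖τ‖ * (‖τ‖ / (2 * π))⁻¹ = 2 * (π / ‖τ‖) ^ 2 by field_simp,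
    Real.sqrt_mul zero_le_two, Real.sqrt_sq (by positivity), div_eq_mul_inv, mul_assoc]

theorem ofReal_mul_cpow {r : ℝ} (hr : 0 < r) (z w : ℂ) :
    ((r : ℂ) * z) ^ w = (r : ℂ) ^ w * z ^ w := by
  have hr₀ : (r : ℂ) ≠ 0 := ofReal_ne_zero.2 hr.ne'
  rcases eq_or_ne z 0 with rfl | hz
  · rcases eq_or_ne w 0 with rfl | hw
    · simp only [cpow_zero, mul_one]
    · rw [mul_zero, zero_cpow hw, mul_zero]
  · rw [cpow_def_of_ne_zero (mul_ne_zero hr₀ hz), cpow_def_of_ne_zero hr₀, cpow_def_of_ne_zero hz,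
      log_ofReal_mul hr hz, ofReal_log hr.le, add_mul, exp_add]

theorem sqrt_two_mul_sqrt_pi_div (τ : ℂ) :
    (√2 : ℂ) * (π / (2 * τ)) ^ (1 / 2 : ℂ) = (π / τ) ^ (1 / 2 : ℂ) := by
  have hsqrt : (√2 : ℂ) = (2 : ℝ) ^ (1 / 2 : ℂ) := by
    rw [Real.sqrt_eq_rpow, ofReal_cpow zero_le_two, ofReal_div, ofReal_one, ofReal_ofNat]
  rw [hsqrt, ← ofReal_mul_cpow two_pos, mul_div_assoc', ofReal_ofNat,
    mul_div_mul_left _ _ two_ne_zero]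

theorem eventually_isAmplitude_amplitude (hδ₀ : 0 < δ) (hδ : δ < π) :
    ∀ᶠ τ in Bornology.cobounded ℂ ⊓ 𝓟 (sector δ),
      IsAmplitude (2 / Real.sin (δ / 2)) τ (π * I * exp (logEta τ))
        (amplitude (π * I * exp (logEta τ))) := by
  set κ := Real.sin (δ / 2)
  have hκ : 0 < κ := Real.sin_pos_of_pos_of_lt_pi (by linarith) (by linarith)
  have hκ₁ : κ ≤ 1 := Real.sin_le_one _
  have hlarge := (Real.tendsto_sqrt_atTop.comp
    (tendsto_norm_cobounded_atTop (E := ℂ))).eventually_ge_atTop (1 / κ)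
  filter_upwards [mem_inf_of_left hlarge, mem_inf_of_right (mem_principal_self _)] with τ hτκ hτδ
  replace hτκ : 1 / κ ≤ √‖τ‖ := hτκ
  have hτ : τ ≠ 0 := by
    rintro rfl
    rw [norm_zero, Real.sqrt_zero] at hτκ
    exact hτκ.not_gt (by positivity)
  have hlower : √‖τ‖ ≤ π * ‖exp (logEta τ)‖ := by
    rw [pi_mul_norm_exp_logEta hτ]
    exact Real.sqrt_le_sqrt (by nlinarith [Real.pi_gt_three, norm_nonneg τ])
  have hupper : π * ‖exp (logEta τ)‖ ≤ 2 * √‖τ‖ := by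
    rw [pi_mul_norm_exp_logEta hτ, Real.sqrt_le_left (by positivity), mul_pow,
      Real.sq_sqrt (norm_nonneg τ)]
    nlinarith [Real.pi_le_four, norm_nonneg τ]
  have hre : κ * √‖τ‖ ≤ -(π * I * exp (logEta τ)).re := by
    rw [re_pi_mul_I_mul_exp_logEta, neg_neg, mul_comm]
    have := sin_half_le_sin_logEta_im hδ₀.le hτδ
    gcongr
  rw [div_le_iff₀' hκ] at hτκ
  refine isAmplitude_amplitude ((one_le_div hκ).2 (by linarith)) hτ (by linarith) ?_ ?_
  · rw [norm_mul, norm_mul, norm_I, mul_one, norm_real, Real.norm_of_nonneg Real.pi_nonneg]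
    refine hupper.trans ?_
    gcongr
    exact le_div_self zero_le_two hκ hκ₁
  · rw [div_mul_eq_mul_div, le_div_iff₀ hκ]
    linarith [mul_nonneg hκ.le (Real.sqrt_nonneg ‖τ‖)]

theorem isBigO_saddleIntegral_amplitude_sub (hδ₀ : 0 < δ) (hδ : δ < π) :
    (fun τ => saddleIntegral τ (amplitude (π * I * exp (logEta τ))) -
        (π / τ) ^ (1 / 2 : ℂ) * exp (-(π * I / 8)))
      =O[Bornology.cobounded ℂ ⊓ 𝓟 (sector δ)] fun τ => ‖τ‖⁻¹ := by
  have hsector : ∀ᶠ τ in Bornology.cobounded ℂ ⊓ 𝓟 (sector δ), τ ∈ sector δ :=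
    mem_inf_of_right (mem_principal_self _)
  have hre := tendsto_re_sector hδ₀ hδ
  refine (isBigO_saddleIntegral_sub (Real.sin_pos_of_pos_of_lt_pi hδ₀ hδ) hre
    (hsector.mono fun τ hτ => sin_mul_norm_le_re hδ₀.le hτ)
    (eventually_isAmplitude_amplitude hδ₀ hδ)).congr' ?_ .rfl
  filter_upwards [hre.eventually_gt_atTop 0] with τ hτ
  have hτ₀ : τ ≠ 0 := fun h => hτ.ne' (by rw [h, zero_re])
  have hexp : (π * I * exp (logEta τ)) ^ 2 / (4 * τ) = -(π * I / 8) := by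
    rw [mul_pow, ← exp_nat_mul, Nat.cast_two, exp_two_mul_logEta hτ₀]
    field_simp
    linear_combination 8 * I_sq
  rw [hexp]

theorem isBigO_sqrt_two_mul_saddleIntegral_one_sub (hδ₀ : 0 < δ) (hδ : δ < π) :
    (fun τ => √2 * saddleIntegral (2 * τ) 1 - (π / τ) ^ (1 / 2 : ℂ))
      =O[Bornology.cobounded ℂ ⊓ 𝓟 (sector δ)] fun τ => ‖τ‖⁻¹ := by
  have hsector : ∀ᶠ τ in Bornology.cobounded ℂ ⊓ 𝓟 (sector δ), τ ∈ sector δ :=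
    mem_inf_of_right (mem_principal_self _)
  have hre : ∀ τ : ℂ, (2 * τ).re = 2 * τ.re := fun τ => by simp
  have hO := (isBigO_saddleIntegral_sub (τ := fun τ => 2 * τ)
    (Real.sin_pos_of_pos_of_lt_pi hδ₀ hδ)
    (by simpa only [hre] using (tendsto_re_sector hδ₀ hδ).const_mul_atTop zero_lt_two)
    (hsector.mono fun τ hτ => by
      rw [hre, norm_mul, norm_ofNat]
      linarith [sin_mul_norm_le_re hδ₀.le hτ])
    (.of_forall fun τ => isAmplitude_one le_rfl (2 * τ))).const_mul_left (√2 : ℂ)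
  refine (hO.trans (IsBigO.of_bound' (.of_forall fun τ => ?_))).congr_left fun τ => ?_
  · rw [norm_inv, norm_inv, norm_norm, norm_norm, norm_mul, norm_ofNat, mul_inv]
    linarith [inv_nonneg.2 (norm_nonneg τ)]
  · rw [mul_sub, ← mul_assoc, sqrt_two_mul_sqrt_pi_div, zero_pow two_ne_zero, zero_div, exp_zero,
      mul_one]

/-- The factor `1 + O(|η|⁻¹)` of the asymptotic expansion, in terms of `τ = 1 - s`. -/
noncomputable def correction (τ : ℂ) : ℂ :=
  saddleIntegral τ (amplitude (π * I * exp (logEta τ))) /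
    (exp (-(π * I / 8)) * (√2 * saddleIntegral (2 * τ) 1))

theorem isBigO_norm_inv_norm_sqrt_pi_div_mul :
    (fun τ : ℂ => ‖τ‖⁻¹) =O[Bornology.cobounded ℂ]
      fun τ => ‖(π / τ) ^ (1 / 2 : ℂ)‖ * ‖exp (logEta τ)‖⁻¹ := by
  refine (isBigO_self_const_mul (c := √2 * π) (by positivity) _ _).congr' .rfl ?_
  filter_upwards [Bornology.eventually_ne_cobounded 0] with τ hτ
  exact (norm_sqrt_pi_div_mul_norm_exp_logEta_inv hτ).symm

theorem tendsto_norm_exp_logEta :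
    Tendsto (fun τ => ‖exp (logEta τ)‖) (Bornology.cobounded ℂ) atTop := by
  refine (Real.tendsto_sqrt_atTop.comp
    (tendsto_norm_cobounded_atTop.atTop_div_const (r := 2 * π) (by positivity))).congr' ?_
  filter_upwards [Bornology.eventually_ne_cobounded 0] with τ hτ
  exact (norm_exp_logEta hτ).symm

theorem sqrt_two_mul_saddleIntegral_one_isEquivalent (hδ₀ : 0 < δ) (hδ : δ < π) :
    (fun τ => √2 * saddleIntegral (2 * τ) 1) ~[Bornology.cobounded ℂ ⊓ 𝓟 (sector δ)]
      fun τ => (π / τ) ^ (1 / 2 : ℂ) := by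
  have hsmall : (fun τ => ‖exp (logEta τ)‖⁻¹) =o[Bornology.cobounded ℂ] fun _ => (1 : ℝ) :=
    (isLittleO_one_iff ℝ).2 tendsto_norm_exp_logEta.inv_tendsto_atTop
  have hprod := ((isBigO_refl (fun τ : ℂ => ‖(π / τ) ^ (1 / 2 : ℂ)‖) _).mul_isLittleO hsmall)
  simp only [mul_one, isLittleO_norm_right] at hprod
  exact (isBigO_sqrt_two_mul_saddleIntegral_one_sub hδ₀ hδ).trans_isLittleO <|
    (isBigO_norm_inv_norm_sqrt_pi_div_mul.trans_isLittleO hprod).mono inf_le_left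

theorem sqrt_pi_div_ne_zero (hτ : τ ≠ 0) : (π / τ) ^ (1 / 2 : ℂ) ≠ 0 :=
  (cpow_ne_zero_iff_of_exponent_ne_zero (by norm_num)).2
    (div_ne_zero (ofReal_ne_zero.2 Real.pi_ne_zero) hτ)

theorem eventually_saddleIntegral_one_ne_zero (hδ₀ : 0 < δ) (hδ : δ < π) :
    ∀ᶠ τ in Bornology.cobounded ℂ ⊓ 𝓟 (sector δ), saddleIntegral (2 * τ) 1 ≠ 0 := by
  filter_upwards [(sqrt_two_mul_saddleIntegral_one_isEquivalent hδ₀ hδ).isBigO_symm.eq_zero_imp,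
    mem_inf_of_left (Bornology.eventually_ne_cobounded 0)] with τ himp hτ h
  exact sqrt_pi_div_ne_zero hτ (himp (by rw [h, mul_zero]))

theorem isBigO_correction_sub_one (hδ₀ : 0 < δ) (hδ : δ < π) :
    (fun τ => correction τ - 1) =O[Bornology.cobounded ℂ ⊓ 𝓟 (sector δ)]
      fun τ => ‖exp (logEta τ)‖⁻¹ := by
  set ε := exp (-(π * I / 8)) with hε
  have hε₀ : ε ≠ 0 := exp_ne_zero _
  set numer := fun τ => saddleIntegral τ (amplitude (π * I * exp (logEta τ)))
  have hne : ∀ᶠ τ : ℂ in Bornology.cobounded ℂ ⊓ 𝓟 (sector δ), (π / τ) ^ (1 / 2 : ℂ) ≠ 0 :=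
    mem_inf_of_left <| (Bornology.eventually_ne_cobounded 0).mono fun _ => sqrt_pi_div_ne_zero
  have hdiff := (((isBigO_saddleIntegral_amplitude_sub hδ₀ hδ).const_mul_left ε⁻¹).sub
    (isBigO_sqrt_two_mul_saddleIntegral_one_sub hδ₀ hδ)).trans
      (isBigO_norm_inv_norm_sqrt_pi_div_mul.mono inf_le_left)
  have hratio := isBigO_div_sub_one (f := fun τ => ε⁻¹ * numer τ)
    (sqrt_two_mul_saddleIntegral_one_isEquivalent hδ₀ hδ) hne <| hdiff.congr_left fun τ => by
      rw [Pi.sub_apply, ← hε]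
      field_simp
      ring
  exact hratio.congr_left fun τ => by rw [correction, ← hε, inv_mul_eq_div, div_div]

theorem auxR_eq_mul_correction (hs : s.re < -1) (h : saddleIntegral (2 * (1 - s)) 1 ≠ 0) :
    auxR s = exp (-(π * I / 8)) / √2 * chi s * eta s ^ (s - 1) *
      exp (π * I * (eta s - eta s ^ 2)) * correction (1 - s) := by
  have hsqrt : (√2 : ℂ) ^ 2 = 2 := by
    rw [← ofReal_pow, Real.sq_sqrt zero_le_two, ofReal_ofNat]
  have hs₁ : s ≠ 1 := fun h => by norm_num [h] at hs
  refine mul_right_cancel₀ (mul_ne_zero two_ne_zero h) ?_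
  rw [auxR_mul_saddleIntegral hs, correction, exp_logEta hs₁]
  generalize saddleIntegral (2 * (1 - s)) 1 = S at h ⊢
  field_simp [exp_ne_zero (-(π * I / 8))]
  rw [hsqrt]

end Asymptotics

end RiemannAux

theorem mainTheorem4 (α : ℝ) (hα0 : 0 < α) (hα : α < Real.pi / 4) :
    ∃ U : ℂ → ℂ,
      U =O[Bornology.cobounded ℂ ⊓ 𝓟 (RiemannAux.G α)] (fun s => ‖RiemannAux.eta s‖⁻¹) ∧
      ∀ᶠ s in Bornology.cobounded ℂ ⊓ 𝓟 (RiemannAux.G α),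
        RiemannAux.auxR s =
          Complex.exp (-(Real.pi * Complex.I / 8)) / (Real.sqrt 2 : ℂ) *
            RiemannAux.chi s * RiemannAux.eta s ^ (s - 1) *
            Complex.exp (Real.pi * Complex.I * (RiemannAux.eta s - RiemannAux.eta s ^ 2)) *
            (1 + U s) := by
  have hδ₀ : 0 < 2 * α := by linarith
  have hδ : 2 * α < Real.pi := by linarith
  have hsector := RiemannAux.tendsto_one_sub_sector hα0 hα
  refine ⟨fun s => RiemannAux.correction (1 - s) - 1, ?_, ?_⟩
  · refine ((RiemannAux.isBigO_correction_sub_one hδ₀ hδ).comp_tendsto hsector).congr' .rfl ?_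
    filter_upwards [mem_inf_of_left (Bornology.eventually_ne_cobounded 1)] with s hs
    rw [Function.comp_apply, RiemannAux.exp_logEta hs]
  · filter_upwards [hsector.eventually (RiemannAux.eventually_saddleIntegral_one_ne_zero hδ₀ hδ),
      ((RiemannAux.tendsto_re_sector hδ₀ hδ).comp hsector).eventually_gt_atTop 2] with s hne hre
    rw [add_sub_cancel]
    rw [Function.comp_apply, Complex.sub_re, Complex.one_re] at hre
    exact RiemannAux.auxR_eq_mul_correction (by linarith) hne
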